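/- Let $M$ be a Riemann surface, $n\ge 0$, $\mathcal H=L^2(S^1,\mathbb C^n)$, and let $\mathcal H_+\subset\mathcal H$ be the Hardy space of all functions whose negative Fourier coefficients vanish. Let $(Sf)(\lambda)=\lambda f(\lambda)$ be the forward shift on $\mathcal H$. Let $V(z)$, $z\in M$, be a family of closed subspaces of $\mathcal H$ with $SV(z)\subset V(z)$, such that: (i) $S|V(z)$ is a pure shift, i.e. $\bigcap_{k\ge 0}S^kV(z)=\{0\}$, for all $z\in M$; (ii) the subspaces $V(z)\ominus SV(z)=V(z)\cap(SV(z))^\perp$ form a smooth subbundle of rank $n$ of $M\times C^\infty(S^1,\mathbb C^n)$, i.e. every point of $M$ has an open neighbourhood $U$ on which there are $n$ smooth functions $f_1,\dots,f_n:S^1\times U\to\mathbb C^n$ such that, for each $z\in U$, $f_1(\cdot,z),\dots,f_n(\cdot,z)$ is a basis of $V(z)\ominus SV(z)$. Then there exists a smooth function $\psi:S^1\times M\to \mathrm U(n)$ with $\psi(1,z)=I$ and $V(z)=\psi(\cdot,z)\mathcal H_+$ for all $z\in M$. If, in addition, (iii) $\partial_{\bar z}V\subset V$, i.e. for every open $U\subset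 M$ and every smooth $f:S^1\times U\to\mathbb C^n$ with $f(\cdot,z)\in V(z)$ for all $z\in U$, one has $\partial_{\bar z}f(\cdot,z)\in V(z)$ for all $z\in U$, in every local complex coordinate $z$, then every point of $M$ has an open neighbourhood $U$ with a smooth function $u:S^1\times U\to \mathrm{GL}(n,\mathbb C)$, holomorphic in $z\in U$ for each fixed $\lambda\in S^1$, such that $V(z)=u(\cdot,z)\mathcal H_+$ for all $z\in U$. Moreover, $V$ is a holomorphic subbundle of the trivial Hilbert bundle $M\times\mathcal H$, i.e. every point of $M$ has an open neighbourhood $U$, a closed subspace $F\subset\mathcal H$, and a map $\Theta$ from $U$ to the bounded invertible operators on $\mathcal H$, holomorphic in operator norm, with $V(z)=\Theta(z)F$ for all $z\in U$. -/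

import Mathlib

open scoped Manifold ContDiff ENNReal
open MeasureTheory

noncomputable section

namespace ShiftBundle

/-- The values of our functions: `ℂⁿ` with its Hermitian norm. -/
abbrev Cn (n : ℕ) : Type := EuclideanSpace ℂ (Fin n)

/-- `L²(S¹, ℂⁿ)`. The circle carries its normalized Haar measure, transported to `ℝ / ℤ` by the
parametrization `t ↦ AddCircle.toCircle t = exp (2 π i t)`. -/
abbrev L2 (n : ℕ) : Type :=
  Lp (Cn n) 2 (AddCircle.haarAddCircle : Measure UnitAddCircle)

/-- The element `s` of `L²(S¹, ℂⁿ)` is the class of the function `g` on `S¹`. -/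
def Represents {n : ℕ} (s : L2 n) (g : Circle → Cn n) : Prop :=
  ⇑s =ᵐ[AddCircle.haarAddCircle] fun t : UnitAddCircle => g (AddCircle.toCircle t)

/-- The function `g` on `S¹` belongs (through its class) to the subspace `W` of `L²(S¹, ℂⁿ)`. -/
def FunMem {n : ℕ} (W : Submodule ℂ (L2 n)) (g : Circle → Cn n) : Prop :=
  ∃ s ∈ W, Represents s g

lemma memLp_shift {n : ℕ} (f : L2 n) :
    MemLp (fun t : UnitAddCircle => (AddCircle.toCircle t : ℂ) • f t) 2
      AddCircle.haarAddCircle := by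
  have hc : Continuous fun t : UnitAddCircle => (AddCircle.toCircle t : ℂ) :=
    continuous_subtype_val.comp AddCircle.continuous_toCircle
  have hm : AEStronglyMeasurable (fun t : UnitAddCircle => (AddCircle.toCircle t : ℂ) • f t)
      AddCircle.haarAddCircle :=
    hc.aestronglyMeasurable.smul (Lp.aestronglyMeasurable f)
  exact (Lp.memLp f).of_le hm (Filter.Eventually.of_forall fun t => by
    rw [norm_smul, Circle.norm_coe, one_mul])

/-- The forward shift `(S f)(λ) = λ f(λ)` on `L²(S¹, ℂⁿ)`. -/
def shift (n : ℕ) : L2 n →ₗ[ℂ] L2 n where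
  toFun f := (memLp_shift f).toLp _
  map_add' f g := by
    rw [← MemLp.toLp_add]
    refine MemLp.toLp_congr _ _ ?_
    filter_upwards [Lp.coeFn_add f g] with t ht
    rw [ht, Pi.add_apply, Pi.add_apply, smul_add]
  map_smul' c f := by
    rw [RingHom.id_apply, ← MemLp.toLp_const_smul]
    refine MemLp.toLp_congr _ _ ?_
    filter_upwards [Lp.coeFn_smul c f] with t ht
    rw [ht, Pi.smul_apply, Pi.smul_apply, smul_comm]

lemma shift_coeFn {n : ℕ} (f : L2 n) :
    ⇑(shift n f) =ᵐ[AddCircle.haarAddCircle]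
      fun t : UnitAddCircle => (AddCircle.toCircle t : ℂ) • f t :=
  MemLp.coeFn_toLp (memLp_shift f)

lemma integrable_fourier_smul {n : ℕ} (k : ℤ) (f : L2 n) :
    Integrable (fun t : UnitAddCircle => fourier k t • f t) AddCircle.haarAddCircle := by
  have hf : Integrable (fun t : UnitAddCircle => f t) AddCircle.haarAddCircle :=
    (Lp.memLp f).integrable (by norm_num)
  have hm : AEStronglyMeasurable (fun t : UnitAddCircle => fourier k t • f t)
      AddCircle.haarAddCircle :=
    (map_continuous (fourier k)).aestronglyMeasurable.smul hf.aestronglyMeasurable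
  exact hf.mono hm (Filter.Eventually.of_forall fun t => by
    rw [norm_smul, fourier_apply, Circle.norm_coe, one_mul])

/-- The Hardy space `H₊`: all elements of `L²(S¹, ℂⁿ)` with vanishing negative Fourier
coefficients. -/
def hardy (n : ℕ) : Submodule ℂ (L2 n) where
  carrier := {f | ∀ k : ℤ, k < 0 → fourierCoeff (⇑f) k = 0}
  zero_mem' k _ := by
    rw [fourierCoeff, integral_eq_zero_of_ae]
    filter_upwards [Lp.coeFn_zero (Cn n) 2 (AddCircle.haarAddCircle : Measure UnitAddCircle)]
      with t ht
    rw [ht, Pi.zero_apply, smul_zero]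
  add_mem' {f g} hf hg k hk := by
    have h : fourierCoeff (⇑(f + g)) k = fourierCoeff (⇑f) k + fourierCoeff (⇑g) k := by
      simp only [fourierCoeff]
      rw [← integral_add (integrable_fourier_smul _ f) (integrable_fourier_smul _ g)]
      refine integral_congr_ae ?_
      filter_upwards [Lp.coeFn_add f g] with t ht
      rw [ht, Pi.add_apply, smul_add]
    rw [h, hf k hk, hg k hk, add_zero]
  smul_mem' c f hf k hk := by
    have h : fourierCoeff (⇑(c • f)) k = c • fourierCoeff (⇑f) k := by
      simp only [fourierCoeff]
      rw [← integral_smul]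
      refine integral_congr_ae ?_
      filter_upwards [Lp.coeFn_smul c f] with t ht
      rw [ht, Pi.smul_apply, smul_comm]
    rw [h, hf k hk, smul_zero]

/-- `A W = {A h : h ∈ W}` for a matrix-valued function `A` on the circle and a subspace `W` of
`L²(S¹, ℂⁿ)`. -/
def matMul {n : ℕ} (A : Circle → Matrix (Fin n) (Fin n) ℂ) (W : Submodule ℂ (L2 n)) :
    Submodule ℂ (L2 n) where
  carrier := {f | ∃ h ∈ W, ⇑f =ᵐ[AddCircle.haarAddCircle]
    fun t : UnitAddCircle => (A (AddCircle.toCircle t)).toEuclideanLin (h t)}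
  zero_mem' := by
    refine ⟨0, W.zero_mem, ?_⟩
    filter_upwards [Lp.coeFn_zero (Cn n) 2 (AddCircle.haarAddCircle : Measure UnitAddCircle)]
      with t ht
    rw [ht, Pi.zero_apply, map_zero]
  add_mem' := by
    rintro f g ⟨h, hW, hf⟩ ⟨k, kW, hg⟩
    refine ⟨h + k, W.add_mem hW kW, ?_⟩
    filter_upwards [Lp.coeFn_add f g, Lp.coeFn_add h k, hf, hg] with t h1 h2 h3 h4
    rw [h1, h2, Pi.add_apply, Pi.add_apply, h3, h4, map_add]
  smul_mem' := by
    rintro c f ⟨h, hW, hf⟩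
    refine ⟨c • h, W.smul_mem c hW, ?_⟩
    filter_upwards [Lp.coeFn_smul c f, Lp.coeFn_smul c h, hf] with t h1 h2 h3
    rw [h1, h2, Pi.smul_apply, Pi.smul_apply, h3, map_smul]

/-- `W ⊖ S W = W ∩ (S W)ᗮ`. -/
def wandering {n : ℕ} (W : Submodule ℂ (L2 n)) : Submodule ℂ (L2 n) :=
  W ⊓ (W.map (shift n))ᗮ

/-- `S` restricted to the `S`-invariant subspace `W` is a pure shift: `⋂ k, S ^ k W = {0}`. -/
def IsPureShift {n : ℕ} (W : Submodule ℂ (L2 n)) : Prop :=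
  ⨅ k : ℕ, W.map (shift n ^ k) = ⊥

section Bundles

variable {M : Type*} [TopologicalSpace M] [ChartedSpace ℂ M]

/-- `f` is a smooth (real `C^∞`) `F`-valued function on `S¹ × U`. -/
def SmoothOn {F : Type*} [NormedAddCommGroup F] [NormedSpace ℝ F]
    (f : Circle × M → F) (U : Set M) : Prop :=
  ContMDiffOn ((𝓡 1).prod 𝓘(ℝ, ℂ)) 𝓘(ℝ, F) ∞ f (Set.univ ×ˢ U)

/-- The subspaces `W z` form a smooth subbundle of rank `r` of `M × C^∞(S¹, ℂⁿ)`: near every point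
of `M` there are `r` functions, smooth on `S¹ × U`, whose values at each `z ∈ U` form a basis
of `W z`. -/
def IsSmoothSubbundle {n : ℕ} (r : ℕ) (W : M → Submodule ℂ (L2 n)) : Prop :=
  ∀ z₀ : M, ∃ U : Set M, IsOpen U ∧ z₀ ∈ U ∧
    ∃ (f : Fin r → Circle × M → Cn n) (s : Fin r → M → L2 n),
      (∀ j, SmoothOn (f j) U) ∧
      (∀ j, ∀ z ∈ U, Represents (s j z) fun l => f j (l, z)) ∧
      ∀ z ∈ U, LinearIndependent ℂ (fun j => s j z) ∧
        Submodule.span ℂ (Set.range fun j => s j z) = W z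

/-- The derivative `∂g/∂z̄` at the point `z` with respect to the complex chart `e`. -/
def dbar {n : ℕ} (e : OpenPartialHomeomorph M ℂ) (g : M → Cn n) (z : M) : Cn n :=
  (1 / 2 : ℂ) • (fderiv ℝ (g ∘ e.symm) (e z) 1 +
    Complex.I • fderiv ℝ (g ∘ e.symm) (e z) Complex.I)

/-- `∂_z̄ V ⊂ V`: the `z̄`-derivative, in any complex chart, of each smooth local section of `V` is
again in `V`. -/
def DbarInvariant {n : ℕ} (V : M → Submodule ℂ (L2 n)) : Prop :=
  ∀ (U : Set M) (f : Circle × M → Cn n), IsOpen U → SmoothOn f U →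
    (∀ z ∈ U, FunMem (V z) fun l => f (l, z)) →
    ∀ z ∈ U, ∀ e ∈ atlas ℂ M, z ∈ e.source →
      FunMem (V z) fun l => dbar e (fun w => f (l, w)) z

/-- `V` is a holomorphic subbundle of the trivial Hilbert bundle `M × L²(S¹, ℂⁿ)`: near every point
of `M` a holomorphic automorphism `Θ` of the trivial bundle carries a constant closed subspace `F`
onto `V`. -/
def IsHolomorphicSubbundle {n : ℕ} (V : M → Submodule ℂ (L2 n)) : Prop :=
  ∀ z₀ : M, ∃ U : Set M, IsOpen U ∧ z₀ ∈ U ∧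
    ∃ (F : Submodule ℂ (L2 n)) (Θ : M → (L2 n →L[ℂ] L2 n)),
      IsClosed (F : Set (L2 n)) ∧
      MDifferentiableOn 𝓘(ℂ, ℂ) 𝓘(ℂ, L2 n →L[ℂ] L2 n) Θ U ∧
      ∀ z ∈ U, IsUnit (Θ z) ∧ V z = F.map (Θ z).toLinearMap

end Bundles

end ShiftBundle

end

open ShiftBundle

/-! The unitary frame. If `G` is a continuous element of the wandering subspace V ⊖ SV, then ⟨λᵏG,
G⟩ = 0 for k ≠ 0. These inner products are the Fourier coefficients of |G|², so |G| is constant on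
the circle (`norm_eq_of_mem_wandering`). Hence a basis of V ⊖ SV stays a basis of ℂⁿ at every point
of the circle. Multiplying it on the right by the inverse of its value at λ = 1 gives a frame Ψ with
Ψ(1) = I, which is unitary because its columns have constant norm. Two such frames differ by
wandering functions vanishing at λ = 1, so they coincide; the local frames therefore glue to a
smooth global one. Purity and the Wold decomposition give V = ΨH₊.

The holomorphic frame. Near z₀ put φ(z) = Ψ(z₀)*Ψ(z), so that φ(z₀) = I and the Toeplitz operator
T_φ is invertible. Let g(z) be the matrix with columns in H₊ solving φ g v ∈ v + H₊ᗮ for all v, and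
put u = Ψg. For z close to z₀ one has gH₊ = H₊, hence uH₊ = V. By (iii) the columns of ∂u/∂z̄ are
again in V = ΨH₊, say Ψx with x ∈ H₊. Since Ψ(z₀)*u v − v stays in H₊ᗮ, so does φx, that is T_φ x =
0. Injectivity gives x = 0 and u is holomorphic in z (`dbar_eq_zero`).

Regularity. Inverting T_φ only yields g in L², depending smoothly on z. Smoothness in λ comes from
rotations: the solution for a rotated symbol is the rotated solution, so its orbit under rotation is
smooth in the angle h and in z jointly. A bounded functional applied to the orbit plus its
h-derivative recovers the values of g (`exists_continuous_representative`), and these are then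
jointly smooth (`exists_smooth_birkhoff`). All derivatives in z are taken in the Banach space of
continuous functions on the circle, from which multiplication operators depend linearly and
continuously on their symbol. -/

noncomputable section

namespace ShiftBundle

open AddCircle Set

/-! ### Multiplication operators and Fourier coefficients on L²(S¹, ℂⁿ) -/

/-- Endomorphisms of `ℂⁿ`. -/
abbrev EndCn (n : ℕ) : Type := Cn n →L[ℂ] Cn n

/-- The class in `L²` of a continuous function. -/
def ofCont (n : ℕ) : C(UnitAddCircle, Cn n) →L[ℂ] L2 n :=
  ContinuousMap.toLp 2 haarAddCircle ℂ

lemma ofCont_coeFn {n : ℕ} (f : C(UnitAddCircle, Cn n)) :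
    ⇑(ofCont n f) =ᵐ[haarAddCircle] f :=
  ContinuousMap.coeFn_toLp _ _

lemma ofCont_injective (n : ℕ) : Function.Injective (ofCont n) :=
  ContinuousMap.toLp_injective _

/-- Multiplication by a continuous operator-valued function. -/
def mulOp (n : ℕ) : C(UnitAddCircle, EndCn n) →L[ℂ] L2 n →L[ℂ] L2 n :=
  ((ContinuousLinearMap.id ℂ (EndCn n)).holderL haarAddCircle ∞ 2 2).comp
    (ContinuousMap.toLp ∞ haarAddCircle ℂ)

lemma mulOp_coeFn {n : ℕ} (A : C(UnitAddCircle, EndCn n)) (f : L2 n) :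
    ⇑(mulOp n A f) =ᵐ[haarAddCircle] fun t => A t (f t) := by
  have h := ContinuousLinearMap.coeFn_holder (r := 2) (ContinuousLinearMap.id ℂ (EndCn n))
    (ContinuousMap.toLp ∞ (haarAddCircle : Measure UnitAddCircle) ℂ A) f
  have h2 := ContinuousMap.coeFn_toLp (p := ∞) (𝕜 := ℂ)
    (haarAddCircle : Measure UnitAddCircle) A
  filter_upwards [h, h2] with t h h2
  refine h.trans ?_
  rw [h2]; rfl

lemma mulOp_one (n : ℕ) : mulOp n 1 = 1 := by
  ext1 f
  refine Lp.ext ?_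
  filter_upwards [mulOp_coeFn 1 f] with t h
  rw [h]; rfl

lemma mulOp_mul {n : ℕ} (A B : C(UnitAddCircle, EndCn n)) :
    mulOp n (A * B) = mulOp n A * mulOp n B := by
  ext1 f
  refine Lp.ext ?_
  filter_upwards [mulOp_coeFn (A * B) f, mulOp_coeFn A (mulOp n B f), mulOp_coeFn B f]
    with t h h1 h2
  rw [h, mul_apply_eq_comp, h1, h2]; rfl

/-- `mulOp` as a ring homomorphism. -/
def mulOpHom (n : ℕ) : C(UnitAddCircle, EndCn n) →* (L2 n →L[ℂ] L2 n) where
  toFun := mulOp n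
  map_one' := mulOp_one n
  map_mul' := mulOp_mul

/-- Applying an operator-valued function pointwise. -/
def appC {n : ℕ} (A : C(UnitAddCircle, EndCn n)) (g : C(UnitAddCircle, Cn n)) :
    C(UnitAddCircle, Cn n) :=
  ⟨fun t => A t (g t), A.continuous.clm_apply g.continuous⟩

lemma mulOp_ofCont {n : ℕ} (A : C(UnitAddCircle, EndCn n)) (g : C(UnitAddCircle, Cn n)) :
    mulOp n A (ofCont n g) = ofCont n (appC A g) := by
  refine Lp.ext ?_
  filter_upwards [mulOp_coeFn A (ofCont n g), ofCont_coeFn g, ofCont_coeFn (appC A g)]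
    with t h h1 h2
  rw [h, h1, h2]; rfl

/-- The `i`-th component of an element of `L²(S¹, ℂⁿ)`. -/
def component {n : ℕ} (i : Fin n) : L2 n →L[ℂ] Lp ℂ 2 (haarAddCircle : Measure UnitAddCircle) :=
  (EuclideanSpace.proj i : Cn n →L[ℂ] ℂ).compLpL 2 haarAddCircle

lemma component_coeFn {n : ℕ} (i : Fin n) (f : L2 n) :
    ⇑(component i f) =ᵐ[haarAddCircle] fun t => f t i :=
  ContinuousLinearMap.coeFn_compLpL _ f

lemma ext_component {n : ℕ} {f g : L2 n} (h : ∀ i, component i f = component i g) : f = g := by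
  refine Lp.ext ?_
  have : ∀ᵐ t ∂(haarAddCircle : Measure UnitAddCircle), ∀ i, f t i = g t i := by
    rw [ae_all_iff]
    intro i
    filter_upwards [component_coeFn i f, component_coeFn i g] with t h1 h2
    rw [← h1, ← h2, h i]
  filter_upwards [this] with t ht
  ext i; exact ht i

/-- The `k`-th Fourier coefficient of the `i`-th component. -/
def coeffL {n : ℕ} (k : ℤ) (i : Fin n) : L2 n →L[ℂ] ℂ :=
  (innerSL ℂ (fourierLp 2 k)).comp (component i)

lemma coeffL_eq_component {n : ℕ} (k : ℤ) (i : Fin n) (f : L2 n) :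
    coeffL k i f = fourierCoeff (⇑(component i f)) k := by
  rw [← fourierBasis_repr, HilbertBasis.repr_apply_apply, coe_fourierBasis]; rfl

lemma coeffL_eq {n : ℕ} (k : ℤ) (i : Fin n) (f : L2 n) :
    coeffL k i f = fourierCoeff (fun t => f t i) k := by
  rw [coeffL_eq_component]
  exact congrFun (fourierCoeff_congr_ae (component_coeFn i f)) k

lemma coeffL_eq_apply {n : ℕ} (k : ℤ) (i : Fin n) (f : L2 n) :
    coeffL k i f = fourierCoeff (⇑f) k i := by
  rw [coeffL_eq, fourierCoeff, fourierCoeff]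
  exact (EuclideanSpace.proj i : Cn n →L[ℂ] ℂ).integral_comp_comm (integrable_fourier_smul (-k) f)

lemma ext_coeffL {n : ℕ} {f g : L2 n} (h : ∀ k i, coeffL k i f = coeffL k i g) : f = g := by
  refine ext_component fun i => ?_
  refine fourierBasis.repr.injective (lp.ext ?_)
  funext k
  have := h k i
  rw [HilbertBasis.repr_apply_apply, HilbertBasis.repr_apply_apply, coe_fourierBasis]
  exact this

lemma mem_hardy_iff {n : ℕ} {f : L2 n} : f ∈ hardy n ↔ ∀ k < 0, ∀ i, coeffL k i f = 0 := by
  constructor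
  · intro h k hk i
    rw [coeffL_eq_apply, h k hk]; rfl
  · intro h k hk
    ext i
    rw [← coeffL_eq_apply, h k hk i]; rfl

lemma isClosed_hardy (n : ℕ) : IsClosed (hardy n : Set (L2 n)) := by
  have : (hardy n : Set (L2 n)) = ⋂ k : ℤ, ⋂ _ : k < 0, ⋂ i, (coeffL k i) ⁻¹' {0} := by
    ext f
    simp [mem_hardy_iff]
  rw [this]
  exact isClosed_iInter fun k => isClosed_iInter fun _ => isClosed_iInter fun i =>
    isClosed_singleton.preimage (coeffL k i).continuous

/-! ### Powers of the shift and the Hardy space -/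

/-- The function `λ ↦ λ ^ k` times the identity. -/
def monoC (n : ℕ) (k : ℤ) : C(UnitAddCircle, EndCn n) :=
  ⟨fun t => fourier k t • (1 : EndCn n), (fourier k).continuous.smul continuous_const⟩

/-- `shiftZ n k` is multiplication by `λ ^ k`. -/
def shiftZ (n : ℕ) (k : ℤ) : L2 n →L[ℂ] L2 n := mulOp n (monoC n k)

lemma monoC_add (n : ℕ) (k l : ℤ) : monoC n (k + l) = monoC n k * monoC n l := by
  ext1 t
  change fourier (k + l) t • (1 : EndCn n) = (fourier k t • 1) * (fourier l t • 1)
  rw [fourier_add, smul_mul_smul_comm, one_mul]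

lemma shiftZ_zero (n : ℕ) : shiftZ n 0 = 1 := by
  rw [← mulOp_one, shiftZ]
  congr 1
  ext1 t
  change fourier 0 t • (1 : EndCn n) = 1
  rw [fourier_zero, one_smul]

lemma shiftZ_add {n : ℕ} (k l : ℤ) (f : L2 n) :
    shiftZ n (k + l) f = shiftZ n k (shiftZ n l f) := by
  rw [shiftZ, monoC_add, mulOp_mul]; rfl

lemma shiftZ_coeFn {n : ℕ} (k : ℤ) (f : L2 n) :
    ⇑(shiftZ n k f) =ᵐ[haarAddCircle] fun t => fourier k t • f t := by
  filter_upwards [mulOp_coeFn (monoC n k) f] with t h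
  exact h

lemma shift_eq (n : ℕ) : shift n = (shiftZ n 1).toLinearMap := by
  ext1 f
  refine Lp.ext ?_
  filter_upwards [shift_coeFn f, shiftZ_coeFn 1 f] with t h1 h2
  rw [h1]; refine Eq.trans ?_ h2.symm
  rw [fourier_one]

lemma coeffL_shiftZ {n : ℕ} (m k : ℤ) (i : Fin n) (f : L2 n) :
    coeffL m i (shiftZ n k f) = coeffL (m - k) i f := by
  rw [coeffL_eq, coeffL_eq, fourierCoeff, fourierCoeff]
  refine integral_congr_ae ?_
  filter_upwards [shiftZ_coeFn k f] with t ht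
  rw [ht, PiLp.smul_apply, smul_eq_mul, smul_eq_mul, smul_eq_mul, ← mul_assoc, ← fourier_add,
    show -m + k = -(m - k) by ring]

lemma inner_shiftZ {n : ℕ} (k : ℤ) (f g : L2 n) :
    inner ℂ (shiftZ n k f) (shiftZ n k g) = inner ℂ f g := by
  rw [L2.inner_def, L2.inner_def]
  refine integral_congr_ae ?_
  filter_upwards [shiftZ_coeFn k f, shiftZ_coeFn k g] with t h1 h2
  rw [h1, h2, inner_smul_left, inner_smul_right, ← mul_assoc, mul_comm (starRingEnd ℂ _),
    Complex.mul_conj, Complex.normSq_eq_norm_sq, fourier_apply, Circle.norm_coe]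
  simp

lemma mulOp_shiftZ {n : ℕ} (A : C(UnitAddCircle, EndCn n)) (k : ℤ) (f : L2 n) :
    mulOp n A (shiftZ n k f) = shiftZ n k (mulOp n A f) := by
  change (mulOp n A * mulOp n (monoC n k)) f = (mulOp n (monoC n k) * mulOp n A) f
  rw [← mulOp_mul, ← mulOp_mul]
  congr 2
  ext1 t
  change A t * (fourier k t • (1 : EndCn n)) = (fourier k t • (1 : EndCn n)) * A t
  rw [mul_smul_comm, smul_mul_assoc, one_mul, mul_one]

/-- The class of a constant function. -/
def constL (n : ℕ) (v : Cn n) : L2 n := ofCont n (ContinuousMap.const _ v)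

lemma inner_shiftZ_const {n : ℕ} (k : ℤ) (i : Fin n) (f : L2 n) :
    inner ℂ (shiftZ n k (constL n (EuclideanSpace.single i 1))) f = coeffL k i f := by
  rw [coeffL_eq, fourierCoeff, L2.inner_def]
  refine integral_congr_ae ?_
  filter_upwards [shiftZ_coeFn k (constL n (EuclideanSpace.single i 1)),
    ofCont_coeFn (ContinuousMap.const _ (EuclideanSpace.single i (1 : ℂ)))] with t h1 h2
  rw [h1, constL, h2, inner_smul_left, fourier_neg, smul_eq_mul]
  simp [EuclideanSpace.inner_single_left]

lemma coeffL_constL {n : ℕ} (k : ℤ) (i : Fin n) (v : Cn n) :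
    coeffL k i (constL n v) = if k = 0 then v i else 0 := by
  have h : coeffL k i (constL n v) =
      fourierCoeff (fun t : UnitAddCircle => v i • fourier 0 t) k := by
    rw [coeffL_eq]
    refine congrFun (fourierCoeff_congr_ae ?_) k
    filter_upwards [ofCont_coeFn (ContinuousMap.const UnitAddCircle v)] with t ht
    rw [constL, ht, fourier_zero]; simp
  refine h.trans ((fourierCoeff.const_smul _ (v i) k).trans ?_)
  rw [fourierCoeff_fourier]
  by_cases hk : k = 0
  · simp [hk]
  · simp [hk]

lemma constL_mem_hardy {n : ℕ} (v : Cn n) : constL n v ∈ hardy n := by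
  rw [mem_hardy_iff]
  intro k hk i
  rw [coeffL_constL, if_neg hk.ne]

lemma shiftZ_mem_hardy {n : ℕ} {k : ℤ} (hk : 0 ≤ k) {f : L2 n} (hf : f ∈ hardy n) :
    shiftZ n k f ∈ hardy n := by
  rw [mem_hardy_iff] at hf ⊢
  intro m hm i
  rw [coeffL_shiftZ]
  exact hf _ (by omega) i

instance (n : ℕ) : CompleteSpace (hardy n) := (isClosed_hardy n).completeSpace_coe

/-- For the converse, the projection of f to H₊ has no negative coefficients, and its nonnegative
ones are those of f, because the projection is self-adjoint and fixes λᵏeᵢ. -/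
lemma mem_hardy_orthogonal_iff {n : ℕ} {f : L2 n} :
    f ∈ (hardy n)ᗮ ↔ ∀ k, 0 ≤ k → ∀ i, coeffL k i f = 0 := by
  constructor
  · intro h k hk i
    rw [← inner_shiftZ_const]
    exact h _ (shiftZ_mem_hardy hk (constL_mem_hardy _))
  · intro h
    have key : (hardy n).starProjection f = 0 := by
      refine ext_coeffL fun k i => ?_
      rw [map_zero]
      rcases lt_or_ge k 0 with hk | hk
      · exact mem_hardy_iff.1 ((hardy n).starProjection_apply_mem f) k hk i
      · rw [← inner_shiftZ_const]
        have h1 := (hardy n).inner_starProjection_left_eq_right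
          (shiftZ n k (constL n (EuclideanSpace.single i 1))) f
        rw [← h1, Submodule.starProjection_eq_self_iff.2
          (shiftZ_mem_hardy hk (constL_mem_hardy _)), inner_shiftZ_const, h k hk i]
    exact (Submodule.starProjection_apply_eq_zero_iff _).1 key

/-- A closed subspace containing all `λ ^ k v`, `k ≥ 0`, contains the Hardy space. -/
lemma hardy_le_of_shiftZ_mem {n : ℕ} {W : Submodule ℂ (L2 n)} (hW : IsClosed (W : Set (L2 n)))
    (h : ∀ (k : ℤ) (i : Fin n), 0 ≤ k →
      shiftZ n k (constL n (EuclideanSpace.single i 1)) ∈ W) : hardy n ≤ W := by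
  have hc : IsClosed ((W ⊓ hardy n : Submodule ℂ (L2 n)) : Set (L2 n)) :=
    hW.inter (isClosed_hardy n)
  have : CompleteSpace (W ⊓ hardy n : Submodule ℂ (L2 n)) := hc.completeSpace_coe
  intro f hf
  have hp := (W ⊓ hardy n).starProjection_apply_mem f
  have hg := (W ⊓ hardy n).sub_starProjection_mem_orthogonal f
  set p := (W ⊓ hardy n).starProjection f
  -- The difference lies in H₊ and is orthogonal to W ∩ H₊, which contains every λᵏeᵢ with k ≥ 0; so
  -- all its coefficients vanish.
  have h0 : f - p = 0 := by
    refine ext_coeffL fun k i => ?_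
    rw [map_zero]
    rcases lt_or_ge k 0 with hk | hk
    · exact mem_hardy_iff.1 (sub_mem hf hp.2) k hk i
    · rw [← inner_shiftZ_const]
      exact hg _ ⟨h k i hk, shiftZ_mem_hardy hk (constL_mem_hardy _)⟩
  rw [sub_eq_zero.1 h0]
  exact hp.1

/-- `matMul` by a continuous function is the image under the multiplication operator. -/
lemma matMul_eq_map {n : ℕ} {A : Circle → Matrix (Fin n) (Fin n) ℂ}
    {B : C(UnitAddCircle, EndCn n)}
    (h : ∀ t v, (A (toCircle t)).toEuclideanLin v = B t v) (W : Submodule ℂ (L2 n)) :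
    matMul A W = W.map (mulOp n B).toLinearMap := by
  ext f
  constructor
  · rintro ⟨g, hg, hf⟩
    refine ⟨g, hg, Lp.ext ?_⟩
    filter_upwards [hf, mulOp_coeFn B g] with t h1 h2
    rw [h1, h]; exact h2
  · rintro ⟨g, hg, rfl⟩
    refine ⟨g, hg, ?_⟩
    filter_upwards [mulOp_coeFn B g] with t h1
    rw [h]; exact h1

lemma FunMem.ofCont {n : ℕ} {W : Submodule ℂ (L2 n)} {g : Circle → Cn n}
    {G : C(UnitAddCircle, Cn n)} (h : FunMem W g) (hG : ∀ t, G t = g (toCircle t)) :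
    ShiftBundle.ofCont n G ∈ W := by
  obtain ⟨s, hs, hr⟩ := h
  convert hs
  refine Lp.ext ?_
  filter_upwards [hr, ofCont_coeFn G] with t h1 h2
  rw [h1, h2, hG]

lemma funMem_of_ofCont {n : ℕ} {W : Submodule ℂ (L2 n)} {g : Circle → Cn n}
    {G : C(UnitAddCircle, Cn n)} (h : ofCont n G ∈ W) (hG : ∀ t, G t = g (toCircle t)) :
    FunMem W g := by
  refine ⟨_, h, ?_⟩
  filter_upwards [ofCont_coeFn G] with t h1
  rw [h1, hG]

/-! ### Wandering functions have constant norm -/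

/-- Links orthogonality of the shifts of `G` to the Fourier series of the scalar function |G|². -/
lemma inner_shiftZ_ofCont {n : ℕ} (k : ℤ) (G : C(UnitAddCircle, Cn n)) :
    inner ℂ (shiftZ n k (ofCont n G)) (ofCont n G)
      = fourierCoeff (fun t => ((‖G t‖ ^ 2 : ℝ) : ℂ)) k := by
  rw [L2.inner_def, fourierCoeff]
  refine integral_congr_ae ?_
  filter_upwards [shiftZ_coeFn k (ofCont n G), ofCont_coeFn G] with t h1 h2
  rw [h1, h2, inner_smul_left, fourier_neg, smul_eq_mul, inner_self_eq_norm_sq_to_K]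
  simp

lemma shiftZ_mem {n : ℕ} {V : Submodule ℂ (L2 n)} (hinv : V.map (shift n) ≤ V) (k : ℕ)
    {f : L2 n} (hf : f ∈ V) : shiftZ n k f ∈ V := by
  induction k with
  | zero => simpa [shiftZ_zero] using hf
  | succ k ih =>
    rw [Nat.cast_succ, add_comm (k : ℤ) 1, shiftZ_add]
    refine hinv ⟨_, ih, ?_⟩
    rw [shift_eq]; rfl

/-- For k > 0 the function λᵏf lies in SV, to which f is orthogonal. The case k < 0 follows by
conjugation, as multiplication by λ⁻ᵏ is unitary. -/
lemma inner_shiftZ_wandering {n : ℕ} {V : Submodule ℂ (L2 n)} (hinv : V.map (shift n) ≤ V)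
    {f : L2 n} (hf : f ∈ wandering V) {k : ℤ} (hk : k ≠ 0) :
    inner ℂ (shiftZ n k f) f = 0 := by
  have pos : ∀ m : ℕ, inner ℂ (shiftZ n ((m : ℤ) + 1) f) f = 0 := by
    intro m
    refine hf.2 _ ⟨shiftZ n m f, shiftZ_mem hinv m hf.1, ?_⟩
    rw [add_comm, shiftZ_add, shift_eq]; rfl
  rcases lt_or_gt_of_ne hk with h | h
  · have h1 := inner_shiftZ (-k) (shiftZ n k f) f
    rw [← shiftZ_add, neg_add_cancel, shiftZ_zero] at h1
    rw [← h1, ← inner_conj_symm]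
    obtain ⟨m, hm⟩ := Int.eq_ofNat_of_zero_le (show 0 ≤ -k - 1 by omega)
    have := pos m
    rw [show ((m : ℤ) + 1) = -k by omega] at this
    rw [one_apply_eq_self, this, map_zero]
  · obtain ⟨m, hm⟩ := Int.eq_ofNat_of_zero_le (show 0 ≤ k - 1 by omega)
    have := pos m
    rwa [show ((m : ℤ) + 1) = k by omega] at this

/-- Continuous functions in the wandering subspace have constant norm. -/
lemma norm_eq_of_mem_wandering {n : ℕ} {V : Submodule ℂ (L2 n)} (hinv : V.map (shift n) ≤ V)
    {G : C(UnitAddCircle, Cn n)} (hG : ofCont n G ∈ wandering V) (t t' : UnitAddCircle) :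
    ‖G t‖ = ‖G t'‖ := by
  let N : C(UnitAddCircle, ℂ) := ⟨fun t => ((‖G t‖ ^ 2 : ℝ) : ℂ), by fun_prop⟩
  have h0 : ∀ k : ℤ, k ≠ 0 → fourierCoeff N k = 0 := fun k hk =>
    (inner_shiftZ_ofCont k G).symm.trans (inner_shiftZ_wandering hinv hG hk)
  have hs : Summable (fourierCoeff N) :=
    summable_of_ne_finset_zero (s := {0}) fun k hk => h0 k (by simpa using hk)
  -- Only the constant term of the Fourier series of |G|² survives, so the series is summable and
  -- equals the continuous function |G|² at every point.
  have hN : ∀ x, N x = fourierCoeff N 0 := by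
    intro x
    have h1 := has_pointwise_sum_fourier_series_of_summable hs x
    refine h1.unique ?_
    convert hasSum_single (0 : ℤ) (f := fun i => fourierCoeff N i • fourier i x) ?_ using 1
    · simp
    · intro k hk
      simp [h0 k hk]
  have h2 : ((‖G t‖ ^ 2 : ℝ) : ℂ) = ((‖G t'‖ ^ 2 : ℝ) : ℂ) := (hN t).trans (hN t').symm
  have h3 : ‖G t‖ ^ 2 = ‖G t'‖ ^ 2 := by exact_mod_cast h2
  exact (pow_left_inj₀ (norm_nonneg _) (norm_nonneg _) two_ne_zero).1 h3

/-- The function `t ↦ A t v`. -/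
def col {n : ℕ} (A : C(UnitAddCircle, EndCn n)) (v : Cn n) : C(UnitAddCircle, Cn n) :=
  appC A (ContinuousMap.const _ v)

@[simp] lemma col_apply {n : ℕ} (A : C(UnitAddCircle, EndCn n)) (v : Cn n) (t : UnitAddCircle) :
    col A v t = A t v := rfl

lemma mulOp_constL {n : ℕ} (A : C(UnitAddCircle, EndCn n)) (v : Cn n) :
    mulOp n A (constL n v) = ofCont n (col A v) := mulOp_ofCont A _

/-- An operator-valued function, equal to the identity at the base point, whose columns lie
in `W`. -/
structure IsNormalizedFrame {n : ℕ} (W : Submodule ℂ (L2 n)) (Ψ : C(UnitAddCircle, EndCn n)) :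
    Prop where
  map_zero : Ψ 0 = 1
  mem : ∀ v, ofCont n (col Ψ v) ∈ W

/-! ### Normalized frames and the Wold decomposition -/

section Frame

variable {n : ℕ} {V : Submodule ℂ (L2 n)} {Ψ Φ : C(UnitAddCircle, EndCn n)}

lemma IsNormalizedFrame.norm_apply (hinv : V.map (shift n) ≤ V)
    (h : IsNormalizedFrame (wandering V) Ψ) (t : UnitAddCircle) (v : Cn n) : ‖Ψ t v‖ = ‖v‖ := by
  have := norm_eq_of_mem_wandering hinv (h.mem v) t 0
  rw [col_apply, col_apply, h.map_zero] at this
  exact this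

/-- The difference of corresponding columns is wandering, so its norm is constant, and it vanishes
at the base point. This uniqueness is what makes local frames glue. -/
lemma IsNormalizedFrame.unique (hinv : V.map (shift n) ≤ V)
    (h : IsNormalizedFrame (wandering V) Ψ) (h' : IsNormalizedFrame (wandering V) Φ) : Ψ = Φ := by
  ext1 t
  refine ContinuousLinearMap.ext fun v => ?_
  have hm : ofCont n (col Ψ v - col Φ v) ∈ wandering V := by
    rw [map_sub]; exact sub_mem (h.mem v) (h'.mem v)
  have := norm_eq_of_mem_wandering hinv hm t 0
  rw [ContinuousMap.sub_apply, ContinuousMap.sub_apply, col_apply, col_apply, col_apply, col_apply,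
    h.map_zero, h'.map_zero, sub_self, norm_zero, norm_eq_zero, sub_eq_zero] at this
  exact this

lemma IsNormalizedFrame.star_mul (hinv : V.map (shift n) ≤ V)
    (h : IsNormalizedFrame (wandering V) Ψ) (t : UnitAddCircle) : star (Ψ t) * Ψ t = 1 :=
  (ContinuousLinearMap.norm_map_iff_adjoint_comp_self (Ψ t)).1 (h.norm_apply hinv t)

lemma EndCn.mul_eq_one_comm {A B : EndCn n} (h : A * B = 1) : B * A = 1 := by
  have h1 : (A.toLinearMap : Module.End ℂ (Cn n)) * B.toLinearMap = 1 := by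
    ext1 v; exact DFunLike.congr_fun h v
  have h2 := _root_.mul_eq_one_comm.1 h1
  ext1 v; exact DFunLike.congr_fun h2 v

lemma IsNormalizedFrame.mul_star (hinv : V.map (shift n) ≤ V)
    (h : IsNormalizedFrame (wandering V) Ψ) (t : UnitAddCircle) : Ψ t * star (Ψ t) = 1 :=
  EndCn.mul_eq_one_comm (h.star_mul hinv t)

/-- The pointwise adjoint. -/
def adjC (Ψ : C(UnitAddCircle, EndCn n)) : C(UnitAddCircle, EndCn n) :=
  ⟨fun t => star (Ψ t), ContinuousLinearMap.adjoint.continuous.comp Ψ.continuous⟩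

/-- Writing the image as a preimage under the continuous inverse makes its closedness immediate. -/
lemma map_mulOp_eq_comap {A B : C(UnitAddCircle, EndCn n)} (h : A * B = 1) (h' : B * A = 1)
    (W : Submodule ℂ (L2 n)) :
    W.map (mulOp n A).toLinearMap = W.comap (mulOp n B).toLinearMap := by
  have e1 : ∀ f, mulOp n A (mulOp n B f) = f := fun f => by
    rw [← mul_apply_eq_comp, ← mulOp_mul, h, mulOp_one]; rfl
  have e2 : ∀ f, mulOp n B (mulOp n A f) = f := fun f => by
    rw [← mul_apply_eq_comp, ← mulOp_mul, h', mulOp_one]; rfl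
  ext f
  constructor
  · rintro ⟨g, hg, rfl⟩
    rw [Submodule.mem_comap, ContinuousLinearMap.coe_coe, ContinuousLinearMap.coe_coe, e2]
    exact hg
  · intro hf
    rw [Submodule.mem_comap, ContinuousLinearMap.coe_coe] at hf
    rw [← e1 f]
    exact Submodule.mem_map_of_mem hf

/-- If `f ∈ V` is orthogonal to all `S ^ m w` with `w` wandering then `f ∈ ⋂ S ^ k V`. -/
lemma mem_map_shift_pow (hclosed : IsClosed (V : Set (L2 n))) (hinv : V.map (shift n) ≤ V)
    (k : ℕ) : ∀ f ∈ V, (∀ (m : ℕ), ∀ w ∈ wandering V, inner ℂ (shiftZ n m w) f = 0) →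
      f ∈ V.map (shift n ^ k) := by
  have hcl : IsClosed ((V.map (shift n) : Submodule ℂ (L2 n)) : Set (L2 n)) := by
    have h1 : V.map (shift n) = V.comap (shiftZ n (-1)).toLinearMap := by
      rw [shift_eq]
      refine map_mulOp_eq_comap ?_ ?_ V
      all_goals
        rw [← monoC_add]
        ext1 t
        simp [monoC]
    rw [h1]
    exact hclosed.preimage (shiftZ n (-1)).continuous
  have : CompleteSpace (V.map (shift n)) := hcl.completeSpace_coe
  induction k with
  | zero => intro f hf _; exact ⟨f, hf, by simp⟩
  | succ k ih =>
    intro f hf horth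
    have hp := (V.map (shift n)).starProjection_apply_mem f
    have hq := (V.map (shift n)).sub_starProjection_mem_orthogonal f
    set p := (V.map (shift n)).starProjection f
    -- The component of f orthogonal to SV is wandering, hence orthogonal to f by the case m = 0,
    -- and to p as well; so it is zero and f lies in SV.
    have hw : f - p ∈ wandering V := ⟨sub_mem hf (hinv hp), hq⟩
    have h1 : inner ℂ (f - p) f = 0 := by
      have := horth 0 _ hw
      rwa [Nat.cast_zero, shiftZ_zero, one_apply_eq_self] at this
    have h2 : inner ℂ (f - p) p = 0 := by
      rw [← inner_conj_symm, hq p hp, map_zero]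
    have h3 : f - p = 0 := by
      rw [← inner_self_eq_zero (𝕜 := ℂ), inner_sub_right, h1, h2, sub_zero]
    rw [← sub_eq_zero.1 h3] at hp
    obtain ⟨g, hg, rfl⟩ := hp
    -- As f = S g and S is isometric, orthogonality of f to S^(m+1) w is orthogonality of g to S^m
    -- w, so the induction hypothesis applies to g.
    obtain ⟨g', hg', hg2⟩ := ih g hg fun m w hw => by
      have := horth (m + 1) w hw
      rw [shift_eq, Nat.cast_succ, add_comm (m : ℤ) 1, shiftZ_add] at this
      exact (inner_shiftZ 1 _ _).symm.trans this
    refine ⟨g', hg', ?_⟩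
    rw [← hg2, pow_succ', Module.End.mul_apply]


/-- The preimage of V under multiplication by Ψ is closed and contains every λᵏeᵢ with k ≥ 0,
because multiplication commutes with the shift. -/
lemma map_hardy_le (hclosed : IsClosed (V : Set (L2 n))) (hinv : V.map (shift n) ≤ V)
    (h : ∀ i, ofCont n (col Ψ (EuclideanSpace.single i 1)) ∈ V) :
    (hardy n).map (mulOp n Ψ).toLinearMap ≤ V := by
  rw [Submodule.map_le_iff_le_comap]
  refine hardy_le_of_shiftZ_mem (W := V.comap (mulOp n Ψ).toLinearMap)
    (hclosed.preimage (mulOp n Ψ).continuous) fun k i hk => ?_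
  rw [Submodule.mem_comap, ContinuousLinearMap.coe_coe, mulOp_shiftZ, mulOp_constL]
  obtain ⟨m, rfl⟩ := Int.eq_ofNat_of_zero_le hk
  exact shiftZ_mem hinv m (h i)

lemma isClosed_map_mulOp {A B : C(UnitAddCircle, EndCn n)} (h : A * B = 1) (h' : B * A = 1)
    {W : Submodule ℂ (L2 n)} (hW : IsClosed (W : Set (L2 n))) :
    IsClosed ((W.map (mulOp n A).toLinearMap : Submodule ℂ (L2 n)) : Set (L2 n)) := by
  rw [map_mulOp_eq_comap h h']
  exact hW.preimage (mulOp n B).continuous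

/-- Wold decomposition: a pure shift-invariant subspace is generated by its wandering subspace. -/
lemma eq_of_shiftZ_wandering_mem (hclosed : IsClosed (V : Set (L2 n)))
    (hinv : V.map (shift n) ≤ V) (hpure : IsPureShift V) {W : Submodule ℂ (L2 n)}
    (hW : IsClosed (W : Set (L2 n))) (hle : W ≤ V)
    (hs : ∀ w ∈ wandering V, ∀ m : ℕ, shiftZ n m w ∈ W) : V = W := by
  refine le_antisymm (fun f hf => ?_) hle
  have := hW.completeSpace_coe
  have hp := W.starProjection_apply_mem f
  have hq := W.sub_starProjection_mem_orthogonal f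
  set p := W.starProjection f
  -- The remainder is in V and orthogonal to W, hence to every Sᵐw; it therefore lies in every SᵏV,
  -- and purity kills it.
  have h0 : f - p ∈ (⨅ k : ℕ, V.map (shift n ^ k)) := by
    rw [Submodule.mem_iInf]
    intro k
    exact mem_map_shift_pow hclosed hinv k _ (sub_mem hf (hle hp)) fun m w hw =>
      hq _ (hs w hw m)
  have h0' : f - p ∈ (⊥ : Submodule ℂ (L2 n)) := hpure ▸ h0
  rw [Submodule.mem_bot, sub_eq_zero] at h0'
  rwa [h0']

lemma IsNormalizedFrame.mul_adjC (hinv : V.map (shift n) ≤ V)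
    (h : IsNormalizedFrame (wandering V) Ψ) : Ψ * adjC Ψ = 1 := by
  ext1 t; exact h.mul_star hinv t

lemma IsNormalizedFrame.adjC_mul (hinv : V.map (shift n) ≤ V)
    (h : IsNormalizedFrame (wandering V) Ψ) : adjC Ψ * Ψ = 1 := by
  ext1 t; exact h.star_mul hinv t

/-- ΨH₊ is closed because Ψ is invertible, and it contains Sᵐ(Ψv) = Ψ(λᵐv); the Wold decomposition
does the rest. -/
lemma IsNormalizedFrame.eq_map_hardy (hclosed : IsClosed (V : Set (L2 n)))
    (hinv : V.map (shift n) ≤ V) (hpure : IsPureShift V)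
    (h : IsNormalizedFrame (wandering V) Ψ)
    (hspan : ∀ w ∈ wandering V, ∃ v, w = ofCont n (col Ψ v)) :
    V = (hardy n).map (mulOp n Ψ).toLinearMap := by
  refine eq_of_shiftZ_wandering_mem hclosed hinv hpure
    (isClosed_map_mulOp (h.mul_adjC hinv) (h.adjC_mul hinv) (isClosed_hardy n))
    (map_hardy_le hclosed hinv fun i => (h.mem _).1) fun w hw m => ?_
  obtain ⟨v, rfl⟩ := hspan w hw
  rw [← mulOp_constL, ← mulOp_shiftZ]
  exact Submodule.mem_map_of_mem (shiftZ_mem_hardy (Int.natCast_nonneg m) (constL_mem_hardy v))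

end Frame

/-! ### From a basis of the wandering subspace to a normalized frame -/

section Frame

variable {n : ℕ} {V : Submodule ℂ (L2 n)} {Ψ Φ : C(UnitAddCircle, EndCn n)}

/-- The operator-valued function with columns `f j`. -/
def ofCols (f : Fin n → Cn n) : EndCn n :=
  LinearMap.toContinuousLinearMap
    { toFun := fun v => ∑ j, v j • f j
      map_add' := fun v w => by simp [add_smul, Finset.sum_add_distrib]
      map_smul' := fun c v => by simp [mul_smul, Finset.smul_sum] }

lemma ofCols_apply (f : Fin n → Cn n) (v : Cn n) : ofCols f v = ∑ j, v j • f j := rfl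

/-- `ofCols` as a continuous linear map. -/
def ofColsL (n : ℕ) : (Fin n → Cn n) →L[ℂ] EndCn n :=
  LinearMap.toContinuousLinearMap
    { toFun := ofCols
      map_add' := fun f g => by
        ext1 v
        simp only [ofCols_apply, add_apply, Pi.add_apply, smul_add,
          Finset.sum_add_distrib]
      map_smul' := fun c f => by
        ext1 v
        simp only [ofCols_apply, smul_apply, Pi.smul_apply, Finset.smul_sum,
          RingHom.id_apply]
        exact Finset.sum_congr rfl fun j _ => smul_comm _ _ _ }

/-- The function `t ↦ ofCols (f · t)`. -/
def colsC (f : Fin n → C(UnitAddCircle, Cn n)) : C(UnitAddCircle, EndCn n) :=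
  ⟨fun t => ofCols fun j => f j t, (ofColsL n).continuous.comp (by fun_prop)⟩

lemma ofCont_col_colsC (f : Fin n → C(UnitAddCircle, Cn n)) (v : Cn n) :
    ofCont n (col (colsC f) v) = ∑ j, v j • ofCont n (f j) := by
  simp_rw [← map_smul]
  rw [← map_sum]
  congr 1
  ext1 t
  rw [ContinuousMap.sum_apply]
  rfl

/-- A continuous basis of the wandering subspace is pointwise invertible. -/
lemma isUnit_colsC (hinv : V.map (shift n) ≤ V) {f : Fin n → C(UnitAddCircle, Cn n)}
    (hli : LinearIndependent ℂ fun j => ofCont n (f j))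
    (hspan : Submodule.span ℂ (Set.range fun j => ofCont n (f j)) = wandering V)
    (t : UnitAddCircle) : IsUnit (colsC f t) := by
  have hmem : ∀ v, ofCont n (col (colsC f) v) ∈ wandering V := fun v => by
    rw [ofCont_col_colsC, ← hspan]
    exact sum_mem fun j _ => Submodule.smul_mem _ _ (Submodule.subset_span ⟨j, rfl⟩)
  -- A kernel vector at one point t gives a combination of the basis that vanishes at t, hence
  -- everywhere by constancy of the norm, contradicting linear independence.
  have hinj : Function.Injective (colsC f t) := by
    rw [injective_iff_map_eq_zero]
    intro v hv
    have h0 : ofCont n (col (colsC f) v) = 0 := by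
      rw [show col (colsC f) v = 0 from ?_, map_zero]
      ext1 t'
      have := norm_eq_of_mem_wandering hinv (hmem v) t' t
      rw [col_apply, col_apply, hv, norm_zero, norm_eq_zero] at this
      exact this
    rw [ofCont_col_colsC] at h0
    ext j
    exact Fintype.linearIndependent_iff.1 hli _ h0 j
  have hl : IsUnit (colsC f t).toLinearMap :=
    (LinearMap.isUnit_iff_ker_eq_bot _).2 (LinearMap.ker_eq_bot.2 hinj)
  obtain ⟨B, hB, hB'⟩ := isUnit_iff_exists.1 hl
  refine isUnit_iff_exists.2 ⟨LinearMap.toContinuousLinearMap B, ?_, ?_⟩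
  · ext1 v; exact DFunLike.congr_fun hB v
  · ext1 v; exact DFunLike.congr_fun hB' v

/-- Normalizing a continuous basis of the wandering subspace. -/
def normalize (F : C(UnitAddCircle, EndCn n)) : C(UnitAddCircle, EndCn n) :=
  F * ContinuousMap.const _ (Ring.inverse (F 0))

lemma isNormalizedFrame_normalize (hinv : V.map (shift n) ≤ V)
    {f : Fin n → C(UnitAddCircle, Cn n)}
    (hli : LinearIndependent ℂ fun j => ofCont n (f j))
    (hspan : Submodule.span ℂ (Set.range fun j => ofCont n (f j)) = wandering V) :
    IsNormalizedFrame (wandering V) (normalize (colsC f)) ∧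
      ∀ w ∈ wandering V, ∃ v, w = ofCont n (col (normalize (colsC f)) v) := by
  have hu := isUnit_colsC hinv hli hspan 0
  have hcol : ∀ v, col (normalize (colsC f)) v = col (colsC f) (Ring.inverse (colsC f 0) v) :=
    fun v => rfl
  refine ⟨⟨Ring.mul_inverse_cancel _ hu, fun v => ?_⟩, fun w hw => ?_⟩
  · rw [hcol, ofCont_col_colsC, ← hspan]
    exact sum_mem fun j _ => Submodule.smul_mem _ _ (Submodule.subset_span ⟨j, rfl⟩)
  · rw [← hspan, Submodule.mem_span_range_iff_exists_fun] at hw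
    obtain ⟨c, hc⟩ := hw
    -- The coordinates c with respect to the original basis become F(0)c with respect to the
    -- normalized one.
    refine ⟨colsC f 0 (WithLp.toLp 2 c), ?_⟩
    rw [hcol, ← mul_apply_eq_comp, Ring.inverse_mul_cancel _ hu, one_apply_eq_self,
      ofCont_col_colsC, ← hc]

end Frame

/-! ### Jointly smooth functions as smooth maps into C(S¹) -/

section CurryCircle

variable {E F : Type*} [NormedAddCommGroup E] [NormedSpace ℝ E] [NormedAddCommGroup F]
  [NormedSpace ℝ F]

/-- Pointwise evaluation of a family of operators indexed by the circle. -/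
def applyC : C(UnitAddCircle, E →L[ℝ] F) →L[ℝ] E →L[ℝ] C(UnitAddCircle, F) :=
  LinearMap.mkContinuous₂
    (LinearMap.mk₂ ℝ
      (fun (A : C(UnitAddCircle, E →L[ℝ] F)) v =>
        (⟨fun t => A t v, A.continuous.clm_apply continuous_const⟩ : C(UnitAddCircle, F)))
      (fun _ _ _ => rfl) (fun _ _ _ => rfl)
      (fun A v w => by ext1 t; exact (A t).map_add v w)
      (fun c A v => by ext1 t; exact (A t).map_smul c v)) 1 fun A v => by
        rw [one_mul]
        refine (ContinuousMap.norm_le _ (by positivity)).2 fun t => ?_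
        exact ((A t).le_opNorm v).trans
          (mul_le_mul_of_nonneg_right (A.norm_coe_le_norm t) (norm_nonneg v))

lemma applyC_apply (A : C(UnitAddCircle, E →L[ℝ] F)) (v : E) (t : UnitAddCircle) :
    applyC A v t = A t v := rfl

/-- The projection ℝ → ℝ/ℤ is an open quotient map, and open quotient maps are stable under
products. -/
lemma continuous_of_comp_coe {X Y : Type*} [TopologicalSpace X] [TopologicalSpace Y]
    {g : X × UnitAddCircle → Y} (h : Continuous fun p : X × ℝ => g (p.1, (p.2 : UnitAddCircle))) :
    Continuous g := by
  have hq : IsOpenQuotientMap (fun p : X × ℝ => (p.1, (p.2 : UnitAddCircle))) :=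
    IsOpenQuotientMap.id.prodMap QuotientAddGroup.isOpenQuotientMap_mk
  exact hq.isQuotientMap.continuous_iff.2 h

lemma continuousOn_toC {E F : Type*} [TopologicalSpace E] [NormedAddCommGroup F] {Ω : Set E} {f : E × ℝ → F} {Φ : E → C(UnitAddCircle, F)}
    (hΦ : ∀ x ∈ Ω, ∀ h : ℝ, Φ x h = f (x, h)) (hf : ContinuousOn f (Ω ×ˢ univ)) :
    ContinuousOn Φ Ω := by
  rw [continuousOn_iff_continuous_domRestrict]
  refine ContinuousMap.continuous_of_continuous_uncurry _ ?_
  refine continuous_of_comp_coe (X := Ω) ?_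
  have h1 : Continuous fun p : Ω × ℝ => f ((p.1 : E), p.2) :=
    hf.comp_continuous (by fun_prop) fun p => ⟨p.1.2, mem_univ _⟩
  refine h1.congr fun p => ?_
  exact (hΦ p.1 p.1.2 p.2).symm

/-- The derivative in the parameter, as a continuous function on the circle. -/
lemma exists_fderivC {Ω : Set E} (hΩ : IsOpen Ω) {f : E × ℝ → F} {Φ : E → C(UnitAddCircle, F)}
    (hΦ : ∀ x ∈ Ω, ∀ h : ℝ, Φ x h = f (x, h)) (hf : ContDiffOn ℝ 1 f (Ω ×ˢ univ)) :
    ∃ Φ' : E → C(UnitAddCircle, E →L[ℝ] F),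
      (∀ x ∈ Ω, ∀ h : ℝ, Φ' x h = (fderiv ℝ f (x, h)).comp (ContinuousLinearMap.inl ℝ E ℝ)) ∧
      (∀ x ∈ Ω, ∀ t, HasFDerivAt (fun y => Φ y t) (Φ' x t) x) ∧
      ∀ x ∈ Ω, HasFDerivAt Φ (applyC (Φ' x)) x := by
  classical
  have hop : IsOpen (Ω ×ˢ (univ : Set ℝ)) := hΩ.prod isOpen_univ
  have hd : ∀ x ∈ Ω, ∀ h : ℝ, HasFDerivAt (fun y => Φ y h)
      ((fderiv ℝ f (x, h)).comp (ContinuousLinearMap.inl ℝ E ℝ)) x := by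
    intro x hx h
    have h1 : HasFDerivAt f (fderiv ℝ f (x, h)) (x, h) :=
      ((hf.contDiffAt (hop.mem_nhds ⟨hx, mem_univ _⟩)).differentiableAt one_ne_zero).hasFDerivAt
    have h2 : HasFDerivAt (fun y : E => (y, h)) (ContinuousLinearMap.inl ℝ E ℝ) x :=
      hasFDerivAt_prodMk_left x h
    refine (h1.comp x h2).congr_of_eventuallyEq ?_
    filter_upwards [hΩ.mem_nhds hx] with y hy
    exact hΦ y hy h
  have hcont : ContinuousOn (fderiv ℝ f) (Ω ×ˢ univ) := hf.continuousOn_fderiv_of_isOpen hop le_rfl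
  -- The parameter derivative is defined intrinsically on the circle, so its continuity may be
  -- tested on the lift to ℝ.
  have hc : ∀ x ∈ Ω, Continuous fun t : UnitAddCircle => fderiv ℝ (fun y => Φ y t) x := by
    intro x hx
    refine QuotientAddGroup.isOpenQuotientMap_mk.isQuotientMap.continuous_iff.2 ?_
    have : Continuous fun h : ℝ => (fderiv ℝ f (x, h)).comp (ContinuousLinearMap.inl ℝ E ℝ) :=
      (hcont.comp_continuous (by fun_prop : Continuous fun h : ℝ => (x, h))
        fun h => ⟨hx, mem_univ _⟩).clm_comp continuous_const
    refine this.congr fun h => ?_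
    exact (hd x hx h).fderiv.symm
  let Φ' : E → C(UnitAddCircle, E →L[ℝ] F) := fun x =>
    if hx : x ∈ Ω then ⟨fun t => fderiv ℝ (fun y => Φ y t) x, hc x hx⟩ else 0
  have hΦ' : ∀ x ∈ Ω, ∀ t, Φ' x t = fderiv ℝ (fun y => Φ y t) x := by
    intro x hx t
    simp only [Φ', dif_pos hx]; rfl
  have hv : ∀ x ∈ Ω, ∀ h : ℝ,
      Φ' x h = (fderiv ℝ f (x, h)).comp (ContinuousLinearMap.inl ℝ E ℝ) := by
    intro x hx h
    rw [hΦ' x hx, (hd x hx h).fderiv]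
  have hpt : ∀ x ∈ Ω, ∀ t, HasFDerivAt (fun y => Φ y t) (Φ' x t) x := by
    intro x hx t
    induction t using QuotientAddGroup.induction_on with
    | H h => exact (hv x hx h).symm ▸ hd x hx h
  have hcΦ' : ContinuousOn Φ' Ω := by
    refine continuousOn_toC
      (f := fun p => (fderiv ℝ f p).comp (ContinuousLinearMap.inl ℝ E ℝ)) hv ?_
    exact hcont.clm_comp continuousOn_const
  refine ⟨Φ', hv, hpt, fun x hx => ?_⟩
  refine HasFDerivAt.of_isLittleO (Asymptotics.isLittleO_iff.2 fun ε hε => ?_)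
  -- Continuity of Φ' in the sup norm bounds its oscillation by ε for all t at once; the mean value
  -- inequality on a ball is then uniform in t.
  have hnear : ∀ᶠ y in nhds x, y ∈ Ω ∧ dist (Φ' y) (Φ' x) < ε := by
    have hb := Metric.ball_mem_nhds (Φ' x) hε
    have h1 := (hcΦ'.continuousAt (hΩ.mem_nhds hx)).preimage_mem_nhds hb
    filter_upwards [h1, hΩ.mem_nhds hx] with y hy hyΩ
    exact ⟨hyΩ, hy⟩
  obtain ⟨r, hr, hball⟩ := Metric.eventually_nhds_iff_ball.1 hnear
  filter_upwards [Metric.ball_mem_nhds x hr] with y hy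
  refine (ContinuousMap.norm_le _ (by positivity)).2 fun t => ?_
  have := (convex_ball x r).norm_image_sub_le_of_norm_hasFDerivWithin_le'
    (f := fun y => Φ y t) (f' := fun y => Φ' y t) (φ := Φ' x t) (C := ε)
    (fun w hw => (hpt w (hball w hw).1 t).hasFDerivWithinAt)
    (fun w hw => (dist_eq_norm (Φ' w t) (Φ' x t)).symm.le.trans
      ((ContinuousMap.dist_apply_le_dist t).trans (hball w hw).2.le))
    (Metric.mem_ball_self hr) hy
  rwa [ContinuousMap.sub_apply, ContinuousMap.sub_apply, applyC_apply]

end CurryCircle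

/-- By induction on m, with F varying: the derivative of Φ is `applyC` of a map of the same kind
with values in C(S¹, E →L F). -/
lemma contDiffOn_toC_nat {E : Type} [NormedAddCommGroup E] [NormedSpace ℝ E] {Ω : Set E}
    (hΩ : IsOpen Ω) (m : ℕ) : ∀ {F : Type} [NormedAddCommGroup F] [NormedSpace ℝ F]
    {f : E × ℝ → F} {Φ : E → C(UnitAddCircle, F)}
    (_ : ∀ x ∈ Ω, ∀ h : ℝ, Φ x h = f (x, h)) (_ : ContDiffOn ℝ m f (Ω ×ˢ univ)),
    ContDiffOn ℝ m Φ Ω := by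
  induction m with
  | zero =>
    intro F _ _ f Φ hΦ hf
    rw [Nat.cast_zero, contDiffOn_zero] at hf ⊢
    exact continuousOn_toC hΦ hf
  | succ m ih =>
    intro F _ _ f Φ hΦ hf
    have hop : IsOpen (Ω ×ˢ (univ : Set ℝ)) := hΩ.prod isOpen_univ
    obtain ⟨Φ', h1, -, h3⟩ := exists_fderivC hΩ hΦ (hf.of_le (by simp))
    rw [Nat.cast_succ, contDiffOn_succ_iff_fderiv_of_isOpen hop] at hf
    rw [Nat.cast_succ, contDiffOn_succ_iff_fderiv_of_isOpen hΩ]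
    refine ⟨fun x hx => (h3 x hx).differentiableAt.differentiableWithinAt, by simp, ?_⟩
    have h4 : ContDiffOn ℝ m Φ' Ω := ih
      (f := fun p => (fderiv ℝ f p).comp (ContinuousLinearMap.inl ℝ E ℝ)) h1
      (hf.2.2.clm_comp contDiffOn_const)
    exact (applyC.contDiff.comp_contDiffOn h4).congr
      fun x hx => (h3 x hx).fderiv.trans (Function.comp_apply).symm

/-- A smooth function of `x` and of a point of the circle is a smooth map to the continuous
functions on the circle. -/
lemma contDiffOn_toC {E F : Type} [NormedAddCommGroup E] [NormedSpace ℝ E] [NormedAddCommGroup F]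
    [NormedSpace ℝ F] {Ω : Set E} (hΩ : IsOpen Ω) {f : E × ℝ → F} {Φ : E → C(UnitAddCircle, F)}
    (hΦ : ∀ x ∈ Ω, ∀ h : ℝ, Φ x h = f (x, h)) (hf : ContDiffOn ℝ ∞ f (Ω ×ˢ univ)) :
    ContDiffOn ℝ ∞ Φ Ω := by
  rw [contDiffOn_infty] at hf ⊢
  exact fun m => contDiffOn_toC_nat hΩ m hΦ (hf m)

/-! ### Charts on M and the angle coordinate -/

section Manifold

attribute [local instance] finrank_real_complex_fact'

variable {M : Type*} [TopologicalSpace M] [ChartedSpace ℂ M]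

lemma isManifold_real [IsManifold 𝓘(ℂ, ℂ) ω M] : IsManifold 𝓘(ℝ, ℂ) ∞ M := by
  refine isManifold_of_contDiffOn _ _ _ fun e e' he he' => ?_
  have h := HasGroupoid.compatible (G := contDiffGroupoid ω 𝓘(ℂ, ℂ)) he he'
  rw [contDiffGroupoid, mem_groupoid_of_pregroupoid] at h
  exact (ContDiffOn.restrict_scalars ℝ h.1).of_le le_top

/-- The function `f` in the coordinate `e` on `M` and the angle coordinate on `S¹`. -/
def pull {F : Type*} (e : OpenPartialHomeomorph M ℂ) (f : Circle × M → F) : ℝ × ℂ → F :=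
  fun p => f (toCircle (p.1 : UnitAddCircle), e.symm p.2)

lemma contMDiff_toCircle : ContMDiff 𝓘(ℝ, ℝ) (𝓡 1) ∞
    fun h : ℝ => toCircle (h : UnitAddCircle) := by
  have h1 : ContMDiff 𝓘(ℝ, ℝ) 𝓘(ℝ, ℝ) ∞ fun h : ℝ => 2 * Real.pi / 1 * h :=
    ContDiff.contMDiff (by fun_prop)
  have h2 := (contMDiff_circleExp (m := ∞)).comp h1
  refine h2.congr fun h => ?_
  rw [toCircle_apply_mk]; rfl

lemma contDiffOn_pull [IsManifold 𝓘(ℝ, ℂ) ∞ M] {F : Type*} [NormedAddCommGroup F]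
    [NormedSpace ℝ F] {e : OpenPartialHomeomorph M ℂ} (he : e ∈ atlas ℂ M)
    {f : Circle × M → F} {U : Set M} (hf : SmoothOn f U) :
    ContDiffOn ℝ ∞ (pull e f) (univ ×ˢ (e.target ∩ e.symm ⁻¹' U)) := by
  rw [← contMDiffOn_iff_contDiffOn, modelWithCornersSelf_prod]
  have h1 : ContMDiffOn 𝓘(ℝ, ℂ) 𝓘(ℝ, ℂ) ∞ e.symm e.target :=
    contMDiffOn_symm_of_mem_maximalAtlas (IsManifold.subset_maximalAtlas he)
  have h2 := (contMDiff_toCircle.contMDiffOn (s := univ)).prodMap h1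
  have h2' := h2.mono (prod_mono_right (s := univ)
    (inter_subset_left (s := e.target) (t := e.symm ⁻¹' U)))
  have h3 := ContMDiffOn.comp hf h2' fun p hp => ⟨mem_univ _, hp.2.2⟩
  rw [← chartedSpaceSelf_prod]
  exact h3

/-- A smooth local angle function. -/
lemma exists_angle (l₀ : Circle) : ∃ θ : Circle → ℝ, ContMDiffAt (𝓡 1) 𝓘(ℝ, ℝ) ∞ θ l₀ ∧
    ∀ l, toCircle ((θ l : ℝ) : UnitAddCircle) = l := by
  -- The argument is measured from l₀, which puts the branch cut at −l₀. The angle is a right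
  -- inverse of `toCircle` everywhere, but smooth only where needed.
  refine ⟨fun l => (Complex.arg l₀ + Complex.arg ((l : ℂ) * (l₀⁻¹ : Circle))) / (2 * Real.pi),
    ?_, fun l => ?_⟩
  · have h1 : ContMDiffAt (𝓡 1) 𝓘(ℝ, ℂ) ∞ (fun l : Circle => (l : ℂ)) l₀ :=
      (contMDiff_coe_sphere (E := ℂ) (n := 1)).contMDiffAt
    have h2 : ContDiffAt ℝ ∞ (fun w : ℂ => (Complex.arg l₀ +
        (Complex.log (w * (l₀⁻¹ : Circle))).im) / (2 * Real.pi)) (l₀ : ℂ) := by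
      have h3 : ContDiffAt ℝ ∞ (fun w : ℂ => Complex.log (w * (l₀⁻¹ : Circle))) (l₀ : ℂ) := by
        have h4 : ContDiffAt ℂ ∞ (fun w : ℂ => Complex.log (w * (l₀⁻¹ : Circle))) (l₀ : ℂ) := by
          refine (Complex.contDiffAt_log ?_).comp (l₀ : ℂ) (by fun_prop)
          rw [← Circle.coe_mul, mul_inv_cancel]
          simp
        exact h4.restrict_scalars ℝ
      have h5 := Complex.imCLM.contDiff.contDiffAt.comp (l₀ : ℂ) h3
      exact (contDiffAt_const.add h5).div_const _
    have h6 := h2.contMDiffAt.comp l₀ h1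
    refine h6.congr_of_eventuallyEq (Filter.Eventually.of_forall fun l => ?_)
    exact congrArg (fun x => (Complex.arg l₀ + x) / (2 * Real.pi)) (Complex.log_im _).symm
  · rw [toCircle_apply_mk, div_one, mul_div_cancel₀ _ (by positivity), Circle.exp_add,
      Circle.exp_arg, ← Circle.coe_mul, Circle.exp_arg, mul_comm l, mul_inv_cancel_left]

lemma smoothOn_of_pull [IsManifold 𝓘(ℝ, ℂ) ∞ M] {F : Type*} [NormedAddCommGroup F]
    [NormedSpace ℝ F] {e : OpenPartialHomeomorph M ℂ} (he : e ∈ atlas ℂ M)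
    {f : Circle × M → F} {U : Set M} (hU : IsOpen U) (hUe : U ⊆ e.source)
    (hf : ContDiffOn ℝ ∞ (pull e f) (univ ×ˢ (e '' U))) : SmoothOn f U := by
  rintro ⟨l₀, z₀⟩ hz
  have hz' : z₀ ∈ U := hz.2
  refine ContMDiffAt.contMDiffWithinAt ?_
  obtain ⟨θ, hθ, hθ'⟩ := exists_angle l₀
  have hop : IsOpen (e '' U) := e.isOpen_image_of_subset_source hU hUe
  have h1 : ContMDiffAt 𝓘(ℝ, ℝ × ℂ) 𝓘(ℝ, F) ∞ (pull e f) (θ l₀, e z₀) :=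
    (hf.contDiffAt ((isOpen_univ.prod hop).mem_nhds
      ⟨mem_univ _, mem_image_of_mem _ hz'⟩)).contMDiffAt
  have h2 : ContMDiffAt 𝓘(ℝ, ℂ) 𝓘(ℝ, ℂ) ∞ e z₀ :=
    contMDiffAt_of_mem_maximalAtlas (IsManifold.subset_maximalAtlas he) (hUe hz')
  have h3 : ContMDiffAt ((𝓡 1).prod 𝓘(ℝ, ℂ)) 𝓘(ℝ, ℝ × ℂ) ∞ (fun p : Circle × M => (θ p.1, e p.2))
      (l₀, z₀) :=
    (hθ.comp (l₀, z₀) contMDiffAt_fst).prodMk_space (h2.comp (l₀, z₀) contMDiffAt_snd)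
  refine (h1.comp (l₀, z₀) h3).congr_of_eventuallyEq ?_
  have h4 : ∀ᶠ p : Circle × M in nhds (l₀, z₀), p.2 ∈ e.source :=
    continuous_snd.continuousAt.eventually (e.open_source.mem_nhds (hUe hz'))
  filter_upwards [h4] with p hp
  simp only [Function.comp_apply, pull]
  rw [hθ', e.left_inv hp]

end Manifold

/-! ### Toeplitz operators -/

section Toeplitz

variable {n : ℕ}

/-- Compression of an operator to the Hardy space. -/
def compress (n : ℕ) : (L2 n →L[ℂ] L2 n) →L[ℂ] (hardy n →L[ℂ] hardy n) :=
  (ContinuousLinearMap.postcomp (hardy n) (hardy n).orthogonalProjectionOnto).comp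
    (ContinuousLinearMap.precomp (L2 n) (hardy n).subtypeL)

/-- The Toeplitz operator with a continuous symbol. -/
def toep (n : ℕ) : C(UnitAddCircle, EndCn n) →L[ℂ] (hardy n →L[ℂ] hardy n) :=
  (compress n).comp (mulOp n)

lemma toep_apply (A : C(UnitAddCircle, EndCn n)) (x : hardy n) :
    toep n A x = (hardy n).orthogonalProjectionOnto (mulOp n A x) := rfl

lemma toep_one : toep n 1 = 1 := by
  ext1 x
  rw [toep_apply, mulOp_one, one_apply_eq_self, one_apply_eq_self,
    Submodule.orthogonalProjectionOnto_mem_subspace_eq_self]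

/-- Restates a Toeplitz equation as A x ∈ y + H₊ᗮ, the form that is compatible with rotations. -/
lemma toep_apply_eq_iff (A : C(UnitAddCircle, EndCn n)) (x y : hardy n) :
    toep n A x = y ↔ mulOp n A x - (y : L2 n) ∈ (hardy n)ᗮ := by
  rw [toep_apply]
  have h : (hardy n).orthogonalProjectionOnto (mulOp n A x - (y : L2 n)) =
      (hardy n).orthogonalProjectionOnto (mulOp n A x) - y := by
    rw [map_sub, Submodule.orthogonalProjectionOnto_mem_subspace_eq_self]
  rw [← Submodule.orthogonalProjectionOnto_eq_zero_iff, h, sub_eq_zero]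

/-- Invertible operators form an open set, the symbol 1 gives the identity, and the Toeplitz
operator is continuous in its symbol. -/
lemma exists_isUnit_toep (n : ℕ) :
    ∃ δ > 0, ∀ A : C(UnitAddCircle, EndCn n), dist A 1 < δ → IsUnit (toep n A) := by
  have h1 : ContinuousAt (toep n) 1 := (toep n).continuous.continuousAt
  have h2 : {T : hardy n →L[ℂ] hardy n | IsUnit T} ∈ nhds (toep n 1) := by
    rw [toep_one]
    exact (Units.isOpen (R := hardy n →L[ℂ] hardy n)).mem_nhds
      (show (1 : hardy n →L[ℂ] hardy n) ∈ {T | IsUnit T} from isUnit_one)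
  obtain ⟨δ, hδ, h⟩ := (Metric.mem_nhds_iff (x := (1 : C(UnitAddCircle, EndCn n)))).1
    (by exact h1.preimage_mem_nhds h2)
  exact ⟨δ, hδ, fun A hA => h hA⟩

lemma contDiff_real_of_clm {X Y : Type*} [NormedAddCommGroup X] [NormedSpace ℂ X]
    [NormedAddCommGroup Y] [NormedSpace ℂ Y] [NormedSpace ℝ X] [NormedSpace ℝ Y]
    [IsScalarTower ℝ ℂ X] [IsScalarTower ℝ ℂ Y] (L : X →L[ℂ] Y) : ContDiff ℝ ∞ L :=
  (L.restrictScalars ℝ).contDiff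

lemma contDiff_toep (n : ℕ) : ContDiff ℝ ∞ (toep n) :=
  @contDiff_real_of_clm C(UnitAddCircle, EndCn n) (hardy n →L[ℂ] hardy n) _ _ _ _ _ _ _ _ (toep n)

lemma contDiffAt_inverse_real {R : Type*} [NormedRing R] [NormedAlgebra ℂ R] [NormedSpace ℝ R]
    [IsScalarTower ℝ ℂ R] [HasSummableGeomSeries R] {x : R} (hx : IsUnit x) :
    ContDiffAt ℝ ∞ (Ring.inverse : R → R) x := by
  obtain ⟨u, rfl⟩ := hx
  exact (contDiffAt_ringInverse ℂ u).restrict_scalars ℝ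

end Toeplitz

/-! ### Rotations of the circle -/

section Rotation

variable {n : ℕ}

/-- Rotation of an element of `L²`. -/
def rot (n : ℕ) (h : UnitAddCircle) : L2 n →ₗᵢ[ℂ] L2 n :=
  Lp.compMeasurePreservingₗᵢ ℂ (fun t => t + h) (measurePreserving_add_right haarAddCircle h)

lemma rot_coeFn (h : UnitAddCircle) (f : L2 n) :
    ⇑(rot n h f) =ᵐ[haarAddCircle] fun t => f (t + h) :=
  Lp.coeFn_compMeasurePreserving f (measurePreserving_add_right haarAddCircle h)

/-- Rotation of a continuous function. -/
def rotC {F : Type*} [TopologicalSpace F] (h : UnitAddCircle) (A : C(UnitAddCircle, F)) :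
    C(UnitAddCircle, F) := A.comp ⟨fun t => t + h, by fun_prop⟩

lemma rotC_apply {F : Type*} [TopologicalSpace F] (h : UnitAddCircle) (A : C(UnitAddCircle, F))
    (t : UnitAddCircle) : rotC h A t = A (t + h) := rfl

lemma coeffL_rot (h : UnitAddCircle) (k : ℤ) (i : Fin n) (f : L2 n) :
    coeffL k i (rot n h f) = fourier k h * coeffL k i f := by
  rw [coeffL_eq, coeffL_eq, fourierCoeff, fourierCoeff]
  have h1 : ∫ t, fourier (-k) t • (rot n h f) t i ∂haarAddCircle =
      ∫ t, (fun t => fourier k h * (fourier (-k) t • f t i)) (t + h) ∂haarAddCircle := by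
    refine integral_congr_ae ?_
    filter_upwards [rot_coeFn h f] with t ht
    simp only [ht, smul_eq_mul, fourier_apply, smul_add, toCircle_add, Circle.coe_mul]
    rw [← mul_assoc, mul_comm _ ((toCircle (-k • t) : ℂ) * _), mul_assoc (toCircle (-k • t) : ℂ),
      ← Circle.coe_mul (toCircle (-k • h)), ← toCircle_add, neg_smul, neg_smul, neg_add_cancel,
      toCircle_zero, Circle.coe_one, mul_one]
  rw [h1, integral_add_right_eq_self (fun t => fourier k h * (fourier (-k) t • f t i)) h,
    integral_const_mul]

lemma mulOp_rotC (h : UnitAddCircle) (A : C(UnitAddCircle, EndCn n)) (f : L2 n) :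
    mulOp n (rotC h A) (rot n h f) = rot n h (mulOp n A f) := by
  refine Lp.ext ?_
  have h3 := (measurePreserving_add_right (haarAddCircle : Measure UnitAddCircle)
    h).quasiMeasurePreserving.ae (mulOp_coeFn A f)
  filter_upwards [mulOp_coeFn (rotC h A) (rot n h f), rot_coeFn h f,
    rot_coeFn h (mulOp n A f), h3] with t h1 h2 h4 h3
  rw [h1, h2, h4, h3, rotC_apply]

lemma rot_constL (h : UnitAddCircle) (v : Cn n) : rot n h (constL n v) = constL n v := by
  refine ext_coeffL fun k i => ?_
  rw [coeffL_rot, coeffL_constL]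
  split_ifs with hk
  · rw [hk, fourier_zero, one_mul]
  · rw [mul_zero]

lemma rot_mem_hardy (h : UnitAddCircle) {f : L2 n} (hf : f ∈ hardy n) : rot n h f ∈ hardy n := by
  rw [mem_hardy_iff] at hf ⊢
  intro k hk i
  rw [coeffL_rot, hf k hk, mul_zero]

lemma rot_mem_hardy_orthogonal (h : UnitAddCircle) {f : L2 n} (hf : f ∈ (hardy n)ᗮ) :
    rot n h f ∈ (hardy n)ᗮ := by
  rw [mem_hardy_orthogonal_iff] at hf ⊢
  intro k hk i
  rw [coeffL_rot, hf k hk, mul_zero]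

/-- With this, a symbol close to 1 has all its rotations close to 1, so their Toeplitz operators are
invertible together. -/
lemma dist_rotC_one (h : UnitAddCircle) (A : C(UnitAddCircle, EndCn n)) :
    dist (rotC h A) 1 ≤ dist A 1 :=
  (ContinuousMap.dist_le dist_nonneg).2
    fun t => ContinuousMap.dist_apply_le_dist (f := A) (g := 1) (t + h)

end Rotation

/-! ### Recovering pointwise values from a differentiable rotation orbit -/

section Evaluation

/-- The Fourier multiplier `(1 + 2 π i k)⁻¹`. -/
def evalWeight (k : ℤ) : ℂ := (1 + 2 * Real.pi * Complex.I * k)⁻¹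

lemma one_add_ne_zero (k : ℤ) : (1 + 2 * Real.pi * Complex.I * k : ℂ) ≠ 0 := by
  intro h
  have := congrArg Complex.re h
  simp at this

lemma memℓp_evalWeight : Memℓp (fun k : ℤ => (starRingEnd ℂ) (evalWeight k)) 2 := by
  refine memℓp_gen ?_
  have h1 : Summable fun k : ℤ => 1 / ((k : ℝ)) ^ 2 :=
    Real.summable_one_div_int_pow.2 one_lt_two
  -- The extra term covers k = 0, where 1 / k² is 0 by convention while the weight is 1.
  have h2 : Summable fun k : ℤ => 1 / ((k : ℝ)) ^ 2 + if k = 0 then (1 : ℝ) else 0 :=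
    h1.add (summable_of_ne_finset_zero (s := {0}) fun k hk => by simp at hk; simp [hk])
  refine Summable.of_nonneg_of_le (fun k => by positivity) (fun k => ?_) h2
  rw [ENNReal.toReal_ofNat, RCLike.norm_conj, evalWeight, norm_inv, Real.rpow_two, inv_pow,
    ← Complex.normSq_eq_norm_sq, Complex.normSq_apply]
  simp only [Complex.add_re, Complex.add_im, Complex.mul_re, Complex.mul_im, Complex.I_re,
    Complex.I_im, Complex.ofReal_re, Complex.ofReal_im, Complex.one_re, Complex.one_im,
    Complex.intCast_re, Complex.intCast_im, Complex.re_ofNat, Complex.im_ofNat]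
  by_cases hk : k = 0
  · simp [hk]
  · rw [if_neg hk, add_zero, one_div]
    have hk2 : (0 : ℝ) < (k : ℝ) ^ 2 := by positivity
    refine inv_anti₀ hk2 ?_
    have := Real.pi_gt_three
    have h9 : 9 < Real.pi ^ 2 := by nlinarith
    nlinarith [mul_lt_mul_of_pos_left h9 hk2]

/-- The representing element of the functional `f ↦ ∑ (1 + 2 π i k)⁻¹ f̂ k`. -/
def evalVec : Lp ℂ 2 (haarAddCircle : Measure UnitAddCircle) :=
  fourierBasis.repr.symm ⟨_, memℓp_evalWeight⟩

/-- The functional `f ↦ ∑ (1 + 2 π i k)⁻¹ f̂ k`; on `f + f'` it is the value of `f` at `0`. -/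
def evalL {n : ℕ} (i : Fin n) : L2 n →L[ℂ] ℂ := (innerSL ℂ evalVec).comp (component i)

lemma hasSum_evalL {n : ℕ} (i : Fin n) (f : L2 n) :
    HasSum (fun k => evalWeight k * coeffL k i f) (evalL i f) := by
  have h := fourierBasis.hasSum_inner_mul_inner evalVec (component i f)
  have h1 : ∀ k, inner ℂ evalVec (fourierBasis k) = evalWeight k := by
    intro k
    rw [← inner_conj_symm, ← HilbertBasis.repr_apply_apply, evalVec,
      LinearIsometryEquiv.apply_symm_apply]
    exact Complex.conj_conj _
  have h2 : ∀ k, inner ℂ (fourierBasis k) (component i f) = coeffL k i f := by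
    intro k
    rw [coe_fourierBasis]; rfl
  simp_rw [h1, h2] at h
  exact h

/-- A differentiable orbit `G h` of the rotation group is represented by a continuous function,
whose value at `h` is `evalL (G h + G' h)`. -/
lemma exists_continuous_representative {n : ℕ} {i : Fin n} {G G' : ℝ → L2 n}
    (hG : ∀ h, HasDerivAt G (G' h) h)
    (hc : ∀ h k, coeffL k i (G h) = fourier k (h : UnitAddCircle) * coeffL k i (G 0)) :
    ∃ Γ : C(UnitAddCircle, ℂ), (⇑Γ =ᵐ[haarAddCircle] ⇑(component i (G 0))) ∧
      ∀ h : ℝ, Γ h = evalL i (G h + G' h) := by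
  set c : ℤ → ℂ := fun k => coeffL k i (G 0) with hcdef
  have h1 : ∀ h k, coeffL k i (G' h) =
      2 * Real.pi * Complex.I * k * (fourier k (h : UnitAddCircle) * c k) := by
    intro h k
    have e1 : HasDerivAt (fun h => coeffL k i (G h)) (coeffL k i (G' h)) h :=
      ((coeffL k i).restrictScalars ℝ).hasFDerivAt.comp_hasDerivAt h (hG h)
    have e2 : HasDerivAt (fun h : ℝ => fourier k (h : UnitAddCircle) * c k)
        (2 * Real.pi * Complex.I * k / (1 : ℝ) * fourier k (h : UnitAddCircle) * c k) h :=
      (hasDerivAt_fourier 1 k h).mul_const (c k)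
    rw [funext fun h => hc h k] at e1
    rw [e1.unique e2]
    push_cast
    ring
  -- The k-th coefficient of G + G' is (1 + 2πik) times that of G, and the weight in `evalL` cancels
  -- this factor; what remains is the Fourier series of G 0 at h.
  have h2 : ∀ h : ℝ, HasSum (fun k => c k * fourier k (h : UnitAddCircle))
      (evalL i (G h + G' h)) := by
    intro h
    refine (hasSum_evalL i (G h + G' h)).congr_fun fun k => ?_
    rw [map_add, h1, hc, evalWeight]
    field_simp [one_add_ne_zero k]
    change _ = c k + _
    ring
  -- At h = 0 all characters equal 1, so the series just obtained is the sum of the coefficients;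
  -- over ℂ summability is absolute.
  have h3 : Summable c := by
    refine (h2 0).summable.congr fun k => ?_
    simp
  have h4 : Summable fun k => c k • (fourier k : C(UnitAddCircle, ℂ)) := by
    refine Summable.of_norm ?_
    refine (summable_norm_iff.2 h3).congr fun k => ?_
    rw [norm_smul, fourier_norm, mul_one]
  obtain ⟨Γ, hΓ⟩ := h4
  refine ⟨Γ, ?_, fun h => ?_⟩
  · have e1 := hΓ.mapL (ContinuousMap.toLp 2 (haarAddCircle : Measure UnitAddCircle) ℂ)
    have e2 := hasSum_fourier_series_L2 (component i (G 0))
    have e3 : ContinuousMap.toLp 2 (haarAddCircle : Measure UnitAddCircle) ℂ Γ =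
        component i (G 0) := by
      refine e1.unique ?_
      refine e2.congr_fun fun k => ?_
      rw [map_smul, hcdef]
      dsimp only
      rw [coeffL_eq_component]
    rw [← e3]
    exact (ContinuousMap.coeFn_toLp _ Γ).symm
  · have e1 := hΓ.mapL (ContinuousMap.evalCLM ℂ (h : UnitAddCircle))
    exact e1.unique (h2 h)

end Evaluation

/-! ### Birkhoff factorization with smooth parameters -/

section Birkhoff

variable {n : ℕ}

/-- A constant function as an element of the Hardy space. -/
def constH (v : Cn n) : hardy n := ⟨constL n v, constL_mem_hardy v⟩

/-- The solution `x ∈ H₊` of `A x ∈ v + H₊ᗮ`. -/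
def toepSolve (A : C(UnitAddCircle, EndCn n)) (v : Cn n) : L2 n :=
  (Ring.inverse (toep n A) (constH v) : hardy n)

lemma toepSolve_mem (A : C(UnitAddCircle, EndCn n)) (v : Cn n) : toepSolve A v ∈ hardy n :=
  (Ring.inverse (toep n A) (constH v)).2

lemma mulOp_toepSolve {A : C(UnitAddCircle, EndCn n)} (hA : IsUnit (toep n A)) (v : Cn n) :
    mulOp n A (toepSolve A v) - constL n v ∈ (hardy n)ᗮ := by
  refine (toep_apply_eq_iff A (Ring.inverse (toep n A) (constH v)) (constH v)).1 ?_
  rw [← mul_apply_eq_comp, Ring.mul_inverse_cancel _ hA, one_apply_eq_self]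

lemma eq_toepSolve {A : C(UnitAddCircle, EndCn n)} (hA : IsUnit (toep n A)) {v : Cn n}
    {x : L2 n} (hx : x ∈ hardy n) (h : mulOp n A x - constL n v ∈ (hardy n)ᗮ) :
    x = toepSolve A v := by
  have h1 := (toep_apply_eq_iff A ⟨x, hx⟩ (constH v)).2 h
  rw [toepSolve, ← h1, ← mul_apply_eq_comp, Ring.inverse_mul_cancel _ hA, one_apply_eq_self]

/-- Rotation preserves H₊, H₊ᗮ and the constants, so the rotated solution solves the rotated
equation, and solutions are unique. -/
lemma toepSolve_rotC {A : C(UnitAddCircle, EndCn n)} (hA : IsUnit (toep n A)) {h : UnitAddCircle}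
    (hA' : IsUnit (toep n (rotC h A))) (v : Cn n) :
    toepSolve (rotC h A) v = rot n h (toepSolve A v) := by
  refine (eq_toepSolve hA' (rot_mem_hardy h (toepSolve_mem A v)) ?_).symm
  have h1 := rot_mem_hardy_orthogonal h (mulOp_toepSolve hA v)
  rwa [map_sub, rot_constL, ← mulOp_rotC] at h1

lemma rotC_zero {F : Type*} [TopologicalSpace F] (A : C(UnitAddCircle, F)) : rotC 0 A = A := by
  ext1 t; rw [rotC_apply, add_zero]

lemma contDiffOn_toepSolve {E : Type*} [NormedAddCommGroup E] [NormedSpace ℝ E] {s : Set E}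
    {A : E → C(UnitAddCircle, EndCn n)} (hA : ContDiffOn ℝ ∞ A s)
    (hu : ∀ x ∈ s, IsUnit (toep n (A x))) (v : Cn n) :
    ContDiffOn ℝ ∞ (fun x => toepSolve (A x) v) s := by
  have h1 : ContDiffOn ℝ ∞ (fun x => toep n (A x)) s :=
    (contDiff_toep n).comp_contDiffOn hA
  have h2 : ContDiffOn ℝ ∞ (fun x => Ring.inverse (toep n (A x))) s := by
    intro x hx
    exact ContDiffAt.comp_contDiffWithinAt x
      (@contDiffAt_inverse_real (hardy n →L[ℂ] hardy n) _ _ _ _ _ _ (hu x hx)) (h1 x hx)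
  exact (((hardy n).subtypeL.comp
    (ContinuousLinearMap.apply ℂ (hardy n) (constH v))).restrictScalars
      ℝ).contDiff.comp_contDiffOn h2

lemma hasDerivAt_partial {F : Type*} [NormedAddCommGroup F] [NormedSpace ℝ F] {Ω : Set ℂ}
    (hΩ : IsOpen Ω) {G : ℝ × ℂ → F} (hG : ContDiffOn ℝ ∞ G (univ ×ˢ Ω)) {w : ℂ} (hw : w ∈ Ω)
    (h : ℝ) : HasDerivAt (fun h : ℝ => G (h, w)) (fderiv ℝ G (h, w) (1, 0)) h := by
  have d1 := ((hG.contDiffAt ((isOpen_univ.prod hΩ).mem_nhds (x := (h, w))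
    ⟨mem_univ _, hw⟩)).differentiableAt (by simp)).hasFDerivAt
  have d2 : HasDerivAt (fun h : ℝ => (h, w)) ((1 : ℝ), (0 : ℂ)) h :=
    (hasDerivAt_id h).prodMk (hasDerivAt_const h w)
  exact d1.comp_hasDerivAt h d2

/-- The solutions for the rotated symbols form a rotation orbit that is differentiable in h because
the symbol is smooth, so the evaluation functional applies. -/
lemma exists_representative_toepSolve {Ω : Set ℂ} (hΩ : IsOpen Ω)
    {φ : ℂ → C(UnitAddCircle, EndCn n)}
    (hu : ∀ (h : UnitAddCircle), ∀ w ∈ Ω, IsUnit (toep n (rotC h (φ w))))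
    (hrot : ContDiffOn ℝ ∞ (fun p : ℝ × ℂ => rotC (p.1 : UnitAddCircle) (φ p.2)) (univ ×ˢ Ω))
    {w : ℂ} (hw : w ∈ Ω) (v : Cn n) (i : Fin n) :
    ∃ Γ : C(UnitAddCircle, ℂ), (⇑Γ =ᵐ[haarAddCircle] ⇑(component i (toepSolve (φ w) v))) ∧
      ∀ h : ℝ, Γ h = evalL i (toepSolve (rotC (h : UnitAddCircle) (φ w)) v +
        fderiv ℝ (fun p : ℝ × ℂ => toepSolve (rotC (p.1 : UnitAddCircle) (φ p.2)) v)
          (h, w) (1, 0)) := by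
  have hG : ContDiffOn ℝ ∞ (fun p : ℝ × ℂ => toepSolve (rotC (p.1 : UnitAddCircle) (φ p.2)) v)
      (univ ×ˢ Ω) := contDiffOn_toepSolve hrot (fun p hp => hu _ _ hp.2) v
  have hu0 : IsUnit (toep n (φ w)) := by
    have := hu 0 w hw
    rwa [rotC_zero] at this
  have e1 : ∀ h : ℝ, HasDerivAt (fun h : ℝ => toepSolve (rotC (h : UnitAddCircle) (φ w)) v)
      (fderiv ℝ (fun p : ℝ × ℂ => toepSolve (rotC (p.1 : UnitAddCircle) (φ p.2)) v)
        (h, w) (1, 0)) h := fun h => hasDerivAt_partial hΩ hG hw h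
  have e0 : toepSolve (rotC ((0 : ℝ) : UnitAddCircle) (φ w)) v = toepSolve (φ w) v := by
    rw [coe_zero, rotC_zero]
  have e2 : ∀ (h : ℝ) k, coeffL k i (toepSolve (rotC (h : UnitAddCircle) (φ w)) v) =
      fourier k (h : UnitAddCircle) *
        coeffL k i (toepSolve (rotC ((0 : ℝ) : UnitAddCircle) (φ w)) v) := by
    intro h k
    rw [e0, ← coeffL_rot, ← toepSolve_rotC hu0 (hu _ w hw)]
  obtain ⟨Γ, h1, h2⟩ := exists_continuous_representative
    (G := fun h : ℝ => toepSolve (rotC (h : UnitAddCircle) (φ w)) v)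
    (G' := fun h : ℝ => fderiv ℝ
      (fun p : ℝ × ℂ => toepSolve (rotC (p.1 : UnitAddCircle) (φ p.2)) v) (h, w) (1, 0)) e1 e2
  beta_reduce at h1
  rw [e0] at h1
  exact ⟨Γ, h1, h2⟩

/-- Smooth dependence on parameters in the Birkhoff factorization. -/
lemma exists_smooth_birkhoff {Ω : Set ℂ} (hΩ : IsOpen Ω) {w₀ : ℂ} (hw₀ : w₀ ∈ Ω)
    {φ : ℂ → C(UnitAddCircle, EndCn n)} {f : ℂ × ℝ → EndCn n}
    (hφ : ∀ w ∈ Ω, ∀ h : ℝ, φ w h = f (w, h)) (hf : ContDiffOn ℝ ∞ f (Ω ×ˢ univ))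
    (h1 : φ w₀ = 1) :
    ∃ Ω' ⊆ Ω, IsOpen Ω' ∧ w₀ ∈ Ω' ∧
      ∃ (g : ℂ → C(UnitAddCircle, EndCn n)) (γ : ℂ × ℝ → EndCn n),
        ContDiffOn ℝ ∞ γ (Ω' ×ˢ univ) ∧ (∀ w ∈ Ω', ∀ h : ℝ, g w h = γ (w, h)) ∧ g w₀ = 1 ∧
        ∀ w ∈ Ω', IsUnit (toep n (φ w)) ∧ ∀ v, ofCont n (col (g w) v) ∈ hardy n ∧
          mulOp n (φ w) (ofCont n (col (g w) v)) - constL n v ∈ (hardy n)ᗮ := by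
  obtain ⟨δ, hδ, hδu⟩ := exists_isUnit_toep n
  set Ω' : Set ℂ := Ω ∩ φ ⁻¹' Metric.ball 1 δ with hΩ'def
  have hΩ' : IsOpen Ω' := (continuousOn_toC hφ hf.continuousOn).isOpen_inter_preimage hΩ
    Metric.isOpen_ball
  have hu : ∀ (h : UnitAddCircle), ∀ w ∈ Ω', IsUnit (toep n (rotC h (φ w))) := fun h w hw =>
    hδu _ ((dist_rotC_one h (φ w)).trans_lt hw.2)
  have hu0 : ∀ w ∈ Ω', IsUnit (toep n (φ w)) := fun w hw => hδu _ hw.2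
  have hop : IsOpen ((univ : Set ℝ) ×ˢ Ω') := isOpen_univ.prod hΩ'
  -- Rotation is not smooth on C(S¹) itself; the rotated symbol is smooth in (h, w) because its
  -- values f(w, s + h) are jointly smooth.
  have hrot : ContDiffOn ℝ ∞ (fun p : ℝ × ℂ => rotC (p.1 : UnitAddCircle) (φ p.2))
      (univ ×ˢ Ω') := by
    refine contDiffOn_toC hop (f := fun q : (ℝ × ℂ) × ℝ => f (q.1.2, q.2 + q.1.1)) ?_ ?_
    · rintro ⟨h, w⟩ hp s
      rw [rotC_apply, ← hφ w hp.2.1]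
      simp
    · exact hf.comp (by fun_prop) fun q hq => ⟨hq.1.2.1, mem_univ _⟩
  let G : Fin n → ℝ × ℂ → L2 n := fun j p =>
    toepSolve (rotC (p.1 : UnitAddCircle) (φ p.2)) (EuclideanSpace.single j 1)
  have hG : ∀ j, ContDiffOn ℝ ∞ (G j) (univ ×ˢ Ω') := fun j =>
    contDiffOn_toepSolve hrot (fun p hp => hu _ _ hp.2) _
  have hGd : ∀ j, ContDiffOn ℝ ∞ (fun p => fderiv ℝ (G j) p (1, 0)) (univ ×ˢ Ω') := fun j =>
    ((hG j).fderiv_of_isOpen hop (by simp)).clm_apply contDiffOn_const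
  have hrep : ∀ w ∈ Ω', ∃ Γ : Fin n → Fin n → C(UnitAddCircle, ℂ), ∀ j i,
      (⇑(Γ j i) =ᵐ[haarAddCircle]
        ⇑(component i (toepSolve (φ w) (EuclideanSpace.single j 1)))) ∧
      ∀ h : ℝ, Γ j i h = evalL i (G j (h, w) + fderiv ℝ (G j) (h, w) (1, 0)) := by
    intro w hw
    have key := fun j i =>
      exists_representative_toepSolve hΩ' hu hrot hw (EuclideanSpace.single j (1 : ℂ)) i
    choose Γ hΓ using key
    exact ⟨Γ, hΓ⟩
  choose! Γ hΓ using hrep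
  let c : ℂ → Fin n → C(UnitAddCircle, Cn n) := fun w j =>
    ⟨fun t => WithLp.toLp 2 fun i => Γ w j i t, by fun_prop⟩
  have hc : ∀ w ∈ Ω', ∀ j, ofCont n (c w j) = toepSolve (φ w) (EuclideanSpace.single j 1) := by
    intro w hw j
    refine ext_component fun i => Lp.ext ?_
    filter_upwards [component_coeFn i (ofCont n (c w j)), ofCont_coeFn (c w j),
      (hΓ w hw j i).1] with t t1 t2 t3
    rw [t1, t2, ← t3]; rfl
  have hcol : ∀ w ∈ Ω', ∀ v, ofCont n (col (colsC (c w)) v) =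
      ∑ j, v j • toepSolve (φ w) (EuclideanSpace.single j 1) := by
    intro w hw v
    rw [ofCont_col_colsC]
    exact Finset.sum_congr rfl fun j _ => by rw [hc w hw]
  have hconst : ∀ v : Cn n, constL n v = ∑ j, v j • constL n (EuclideanSpace.single j 1) := by
    intro v
    refine ext_coeffL fun k i => ?_
    rw [map_sum, coeffL_constL]
    simp only [map_smul, coeffL_constL]
    split_ifs <;> simp
  have hmem : ∀ w ∈ Ω', ∀ v, ofCont n (col (colsC (c w)) v) ∈ hardy n := fun w hw v => by
    rw [hcol w hw]
    exact sum_mem fun j _ => Submodule.smul_mem _ _ (toepSolve_mem _ _)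
  have horth : ∀ w ∈ Ω', ∀ v,
      mulOp n (φ w) (ofCont n (col (colsC (c w)) v)) - constL n v ∈ (hardy n)ᗮ := fun w hw v => by
    rw [hcol w hw, hconst v, map_sum, ← Finset.sum_sub_distrib]
    refine sum_mem fun j _ => ?_
    rw [map_smul, ← smul_sub]
    exact Submodule.smul_mem _ _ (mulOp_toepSolve (hu0 w hw) _)
  have hw₀' : w₀ ∈ Ω' := ⟨hw₀, by rw [mem_preimage, h1]; exact Metric.mem_ball_self hδ⟩
  -- The smooth lift γ of g is the evaluation formula for the representatives, read as a function of
  -- w and the angle together.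
  refine ⟨Ω', inter_subset_left, hΩ', hw₀', fun w => colsC (c w),
    fun q => ofColsL n fun j => WithLp.toLp 2 fun i =>
      evalL i (G j (q.2, q.1) + fderiv ℝ (G j) (q.2, q.1) (1, 0)), ?_, ?_, ?_,
    fun w hw => ⟨hu0 w hw, fun v => ⟨hmem w hw v, horth w hw v⟩⟩⟩
  · refine (contDiff_real_of_clm (ofColsL n)).comp_contDiffOn
      (f := fun q : ℂ × ℝ => fun j => WithLp.toLp 2 fun i =>
        evalL i (G j (q.2, q.1) + fderiv ℝ (G j) (q.2, q.1) (1, 0))) ?_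
    refine contDiffOn_pi.2 fun j => ?_
    rw [contDiffOn_piLp]
    intro i
    refine (contDiff_real_of_clm (evalL i)).comp_contDiffOn
      (f := fun q : ℂ × ℝ => G j (q.2, q.1) + fderiv ℝ (G j) (q.2, q.1) (1, 0)) ?_
    exact ((hG j).add (hGd j)).comp (by fun_prop : ContDiffOn ℝ ∞ (fun q : ℂ × ℝ => (q.2, q.1)) _)
      fun q hq => ⟨mem_univ _, hq.1⟩
  · intro w hw h
    change ofCols _ = ofCols _
    congr 1
    funext j
    change WithLp.toLp 2 _ = WithLp.toLp 2 _
    congr 1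
    funext i
    exact (hΓ w hw j i).2 h
  · ext1 t
    refine ContinuousLinearMap.ext fun v => ?_
    -- At the base point the symbol is 1 and the constant v solves the equation; uniqueness forces g
    -- = 1 there.
    have e1 := eq_toepSolve (hu0 w₀ hw₀') (hmem w₀ hw₀' v) (horth w₀ hw₀' v)
    have e2 : constL n v = toepSolve (φ w₀) v := by
      refine eq_toepSolve (hu0 w₀ hw₀') (constL_mem_hardy v) ?_
      rw [h1, mulOp_one, one_apply_eq_self, sub_self]
      exact zero_mem _
    have e3 := ofCont_injective n (e1.trans e2.symm)
    exact DFunLike.congr_fun e3 t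

end Birkhoff

/-! ### Local frames with vanishing ∂̄-derivative -/

section Holomorphic

variable {n : ℕ}

lemma adjL_contDiff : ContDiff ℝ ∞ (star : EndCn n → EndCn n) := by
  have h : IsBoundedLinearMap ℝ (ContinuousLinearMap.adjoint : EndCn n → EndCn n) :=
    { map_add := fun A B => map_add ContinuousLinearMap.adjoint A B
      map_smul := fun c A => by
        have := ContinuousLinearMap.adjoint.map_smulₛₗ (c : ℂ) A
        rw [Complex.conj_ofReal, Complex.coe_smul, Complex.coe_smul] at this
        exact this
      bound := ⟨1, one_pos, fun A => by
        rw [one_mul]; exact (ContinuousLinearMap.adjoint.norm_map A).le⟩ }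
  exact h.contDiff

lemma contDiffOn_mul_EndCn {E : Type*} [NormedAddCommGroup E] [NormedSpace ℝ E] {s : Set E}
    {A B : E → EndCn n} (hA : ContDiffOn ℝ ∞ A s) (hB : ContDiffOn ℝ ∞ B s) :
    ContDiffOn ℝ ∞ (fun x => A x * B x) s := by
  have h : IsBoundedBilinearMap ℝ fun p : EndCn n × EndCn n => p.1 * p.2 :=
    { add_left := fun _ _ _ => add_mul _ _ _
      smul_left := fun _ _ _ => smul_mul_assoc _ _ _
      add_right := fun _ _ _ => mul_add _ _ _
      smul_right := fun _ _ _ => mul_smul_comm _ _ _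
      bound := ⟨1, one_pos, fun A B => by
        rw [one_mul]; exact A.opNorm_comp_le B⟩ }
  exact h.contDiff.comp_contDiffOn (hA.prodMk hB)

/-- Since A maps H₊ into itself, its Toeplitz operator is plain multiplication by A on H₊, and
invertibility makes that surjective. -/
lemma map_hardy_eq_self {A : C(UnitAddCircle, EndCn n)}
    (hcol : ∀ v, ofCont n (col A v) ∈ hardy n) (hu : IsUnit (toep n A)) :
    (hardy n).map (mulOp n A).toLinearMap = hardy n := by
  have hinv : (hardy n).map (shift n) ≤ hardy n := by
    rintro _ ⟨f, hf, rfl⟩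
    rw [shift_eq]
    exact shiftZ_mem_hardy zero_le_one hf
  have hle := map_hardy_le (isClosed_hardy n) hinv fun i => hcol (EuclideanSpace.single i 1)
  refine le_antisymm hle fun f hf => ?_
  have h1 : toep n A (Ring.inverse (toep n A) ⟨f, hf⟩) = ⟨f, hf⟩ := by
    rw [← mul_apply_eq_comp, Ring.mul_inverse_cancel _ hu, one_apply_eq_self]
  set x := Ring.inverse (toep n A) (⟨f, hf⟩ : hardy n)
  have h2 : mulOp n A x ∈ hardy n := hle (Submodule.mem_map_of_mem x.2)
  have h3 := congrArg Subtype.val h1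
  rw [toep_apply, ← Submodule.starProjection_apply, Submodule.starProjection_eq_self_iff.2 h2] at h3
  rw [← show mulOp n A x = f from h3]
  exact Submodule.mem_map_of_mem x.2

lemma map_mulOp_mul (A B : C(UnitAddCircle, EndCn n)) (W : Submodule ℂ (L2 n)) :
    W.map (mulOp n (A * B)).toLinearMap =
      (W.map (mulOp n B).toLinearMap).map (mulOp n A).toLinearMap := by
  rw [mulOp_mul, ← Submodule.map_comp]
  rfl

lemma col_mul (A B : C(UnitAddCircle, EndCn n)) (v : Cn n) :
    ofCont n (col (A * B) v) = mulOp n A (ofCont n (col B v)) := by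
  rw [← mulOp_constL, ← mulOp_constL, mulOp_mul]; rfl

/-- The functional `A ↦ ⟨y, B A v⟩`. -/
def matrixCoeff (y : L2 n) (B : C(UnitAddCircle, EndCn n)) (v : Cn n) :
    C(UnitAddCircle, EndCn n) →L[ℂ] ℂ :=
  ((innerSL ℂ y).comp ((mulOp n B).comp
    (ContinuousLinearMap.apply ℂ (L2 n) (constL n v)))).comp (mulOp n)

lemma matrixCoeff_apply (y : L2 n) (A B : C(UnitAddCircle, EndCn n)) (v : Cn n) :
    matrixCoeff y B v A = inner ℂ y (ofCont n (col (B * A) v)) := by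
  rw [col_mul, ← mulOp_constL]; rfl

lemma exists_hasFDerivAt_clm {X Y : Type*} [NormedAddCommGroup X] [NormedSpace ℂ X]
    [NormedAddCommGroup Y] [NormedSpace ℂ Y] [NormedSpace ℝ X] [NormedSpace ℝ Y]
    [IsScalarTower ℝ ℂ X] [IsScalarTower ℝ ℂ Y] (m : X →L[ℂ] Y) {u : ℂ → X} {L : ℂ →L[ℝ] X} {w : ℂ}
    (h : HasFDerivAt u L w) :
    ∃ M : ℂ →L[ℝ] Y, HasFDerivAt (fun w => m (u w)) M w ∧ ∀ a, M a = m (L a) :=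
  ⟨(m.restrictScalars ℝ).comp L, (m.restrictScalars ℝ).hasFDerivAt.comp w h, fun _ => rfl⟩

lemma exists_hasFDerivAt_matrixCoeff (y : L2 n) (B : C(UnitAddCircle, EndCn n)) (v : Cn n)
    {u : ℂ → C(UnitAddCircle, EndCn n)} {L : ℂ →L[ℝ] C(UnitAddCircle, EndCn n)} {w : ℂ}
    (h : HasFDerivAt u L w) :
    ∃ M : ℂ →L[ℝ] ℂ, HasFDerivAt (fun w => matrixCoeff y B v (u w)) M w ∧
      ∀ a, M a = matrixCoeff y B v (L a) :=
  @exists_hasFDerivAt_clm C(UnitAddCircle, EndCn n) ℂ _ _ _ _ _ _ _ _ (matrixCoeff y B v) u L w h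

lemma eq_zero_of_mulOp_mem_orthogonal {A : C(UnitAddCircle, EndCn n)} (hA : IsUnit (toep n A))
    {x : L2 n} (hx : x ∈ hardy n) (h : mulOp n A x ∈ (hardy n)ᗮ) : x = 0 := by
  have h0 : constL n (0 : Cn n) = 0 := map_zero (ofCont n)
  have h1 := eq_toepSolve hA (v := 0) hx (by rwa [h0, sub_zero])
  have h2 := eq_toepSolve hA (v := 0) (zero_mem (hardy n))
    (by rw [h0, sub_zero, map_zero]; exact zero_mem _)
  rw [h1, ← h2]

/-- The `∂̄`-derivative of a frame in Birkhoff normal form vanishes if its columns lie in the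
subspace. -/
lemma dbar_eq_zero {u : ℂ → C(UnitAddCircle, EndCn n)} {w : ℂ} {B Φ : C(UnitAddCircle, EndCn n)}
    (hT : IsUnit (toep n (B * Φ)))
    (hu : ∀ᶠ z in nhds w, ∀ v, ofCont n (col (B * u z) v) - constL n v ∈ (hardy n)ᗮ)
    {L : ℂ →L[ℝ] C(UnitAddCircle, EndCn n)} (hL : HasFDerivAt u L w)
    (hmem : ∀ v, ofCont n (col (L 1 + Complex.I • L Complex.I) v) ∈
      (hardy n).map (mulOp n Φ).toLinearMap) :
    L 1 + Complex.I • L Complex.I = 0 := by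
  set D := L 1 + Complex.I • L Complex.I with hD
  have key : ∀ v, col D v = 0 := by
    intro v
    have horth : ofCont n (col (B * D) v) ∈ (hardy n)ᗮ := by
      intro y hy
      rw [← matrixCoeff_apply]
      obtain ⟨M, e1, e1'⟩ := exists_hasFDerivAt_matrixCoeff y B v hL
      -- Pairing B u(z) v with y ∈ H₊ gives ⟨y, v⟩ for all z near w, so the real derivative of the
      -- pairing vanishes in every direction.
      have e2 : HasFDerivAt (fun w => matrixCoeff y B v (u w)) (0 : ℂ →L[ℝ] ℂ) w := by
        refine (hasFDerivAt_const (inner ℂ y (constL n v)) w).congr_of_eventuallyEq ?_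
        filter_upwards [hu] with z hz
        have e3 := hz v y hy
        rw [inner_sub_right, sub_eq_zero] at e3
        rw [matrixCoeff_apply, e3]
      have e5 : ∀ a : ℂ, matrixCoeff y B v (L a) = 0 := fun a => by
        rw [← e1', e1.unique e2]; rfl
      rw [hD, map_add, map_smul, e5, e5, smul_zero, add_zero]
    obtain ⟨x, hx, hxD⟩ := hmem v
    rw [ContinuousLinearMap.coe_coe] at hxD
    have e6 : mulOp n (B * Φ) x = ofCont n (col (B * D) v) := by
      rw [col_mul, ← hxD, mulOp_mul, mul_apply_eq_comp]
    -- With D v = Φ x and x ∈ H₊, the function BΦx = BDv lies in H₊ᗮ, so x is in the kernel of an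
    -- invertible Toeplitz operator.
    have e9 : x = 0 := eq_zero_of_mulOp_mem_orthogonal hT hx (e6 ▸ horth)
    rw [e9, map_zero] at hxD
    exact ofCont_injective n (hxD.symm.trans (map_zero _).symm)
  ext1 t
  exact ContinuousLinearMap.ext fun v => DFunLike.congr_fun (key v) t

lemma adjC_apply (A : C(UnitAddCircle, EndCn n)) (t : UnitAddCircle) : adjC A t = star (A t) := rfl

lemma ofCont_col_mul_mul (A B C : C(UnitAddCircle, EndCn n)) (v : Cn n) :
    ofCont n (col (A * (B * C)) v) = mulOp n (A * B) (ofCont n (col C v)) := by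
  rw [col_mul, col_mul, mulOp_mul, mul_apply_eq_comp]

lemma isOpen_setOf_isUnit : IsOpen {A : C(UnitAddCircle, EndCn n) | IsUnit A} :=
  Units.isOpen (R := C(UnitAddCircle, EndCn n))

lemma map_mulOp_mul_eq {A B : C(UnitAddCircle, EndCn n)}
    (hB : (hardy n).map (mulOp n B).toLinearMap = hardy n) :
    (hardy n).map (mulOp n (A * B)).toLinearMap = (hardy n).map (mulOp n A).toLinearMap := by
  rw [map_mulOp_mul, hB]

/-- Local holomorphic frames: Birkhoff factorization relative to a base point. -/
lemma exists_holomorphic_factor {Ω : Set ℂ} (hΩ : IsOpen Ω) {w₀ : ℂ} (hw₀ : w₀ ∈ Ω)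
    {Ψ : ℂ → C(UnitAddCircle, EndCn n)} {f : ℂ × ℝ → EndCn n}
    (hΨ : ∀ w ∈ Ω, ∀ h : ℝ, Ψ w h = f (w, h)) (hf : ContDiffOn ℝ ∞ f (Ω ×ˢ univ))
    (h1 : ∀ w ∈ Ω, Ψ w * adjC (Ψ w) = 1) (h2 : ∀ w ∈ Ω, adjC (Ψ w) * Ψ w = 1) :
    ∃ Ω' ⊆ Ω, IsOpen Ω' ∧ w₀ ∈ Ω' ∧
      ∃ (u : ℂ → C(UnitAddCircle, EndCn n)) (υ : ℂ × ℝ → EndCn n),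
        ContDiffOn ℝ ∞ υ (Ω' ×ˢ univ) ∧ (∀ w ∈ Ω', ∀ h : ℝ, u w h = υ (w, h)) ∧
        ∀ w ∈ Ω', IsUnit (u w) ∧
          (hardy n).map (mulOp n (u w)).toLinearMap = (hardy n).map (mulOp n (Ψ w)).toLinearMap ∧
          ∀ L : ℂ →L[ℝ] C(UnitAddCircle, EndCn n), HasFDerivAt u L w →
            (∀ v, ofCont n (col (L 1 + Complex.I • L Complex.I) v) ∈
              (hardy n).map (mulOp n (Ψ w)).toLinearMap) →
            L 1 + Complex.I • L Complex.I = 0 := by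
  set B := adjC (Ψ w₀) with hB
  have hfs : ContDiffOn ℝ ∞ (fun q : ℂ × ℝ => f (w₀, q.2)) (Ω ×ˢ univ) :=
    hf.comp (by fun_prop) fun q hq => ⟨hw₀, mem_univ _⟩
  have hBs : ContDiffOn ℝ ∞ (fun q : ℂ × ℝ => star (f (w₀, q.2))) (Ω ×ˢ univ) := by
    exact adjL_contDiff.comp_contDiffOn hfs
  obtain ⟨Ω₁, hΩ₁Ω, hΩ₁, hw₁, g, γ, hγ, hgγ, hg0, hg⟩ :=
    exists_smooth_birkhoff hΩ hw₀ (φ := fun w => B * Ψ w)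
      (f := fun q => star (f (w₀, q.2)) * f q)
      (fun w hw h => by
        rw [ContinuousMap.mul_apply, hΨ w hw]
        rw [hB, adjC_apply, hΨ w₀ hw₀])
      (contDiffOn_mul_EndCn hBs hf) (h2 w₀ hw₀)
  have hgc : ContinuousOn g Ω₁ := continuousOn_toC hgγ hγ.continuousOn
  obtain ⟨δ, hδ, hδu⟩ := exists_isUnit_toep n
  -- The first condition makes the Toeplitz operator of g invertible, so that gH₊ = H₊; the second
  -- makes g itself invertible.
  set Ω' : Set ℂ := (Ω₁ ∩ g ⁻¹' Metric.ball 1 δ) ∩ (Ω₁ ∩ g ⁻¹' {A | IsUnit A}) with hΩ'def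
  have hΩ' : IsOpen Ω' := (hgc.isOpen_inter_preimage hΩ₁ Metric.isOpen_ball).inter
    (hgc.isOpen_inter_preimage hΩ₁ isOpen_setOf_isUnit)
  have hsub : Ω' ⊆ Ω₁ := fun w hw => hw.1.1
  have hw₀' : w₀ ∈ Ω' := by
    refine ⟨⟨hw₁, ?_⟩, hw₁, ?_⟩
    · rw [mem_preimage, hg0]; exact Metric.mem_ball_self hδ
    · rw [mem_preimage, hg0]; exact isUnit_one
  refine ⟨Ω', hsub.trans hΩ₁Ω, hΩ', hw₀', fun w => Ψ w * g w, fun q => f q * γ q, ?_, ?_, ?_⟩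
  · exact contDiffOn_mul_EndCn (hf.mono (prod_mono_left (hsub.trans hΩ₁Ω)))
      (hγ.mono (prod_mono_left hsub))
  · intro w hw h
    rw [ContinuousMap.mul_apply, hΨ w (hΩ₁Ω (hsub hw)), hgγ w (hsub hw)]
  intro w hw
  have hwΩ : w ∈ Ω := hΩ₁Ω (hsub hw)
  obtain ⟨hT, hcol⟩ := hg w (hsub hw)
  have hgH := map_hardy_eq_self (fun v => (hcol v).1) (hδu _ hw.1.2)
  have hΨu : IsUnit (Ψ w) := isUnit_iff_exists.2 ⟨_, h1 w hwΩ, h2 w hwΩ⟩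
  refine ⟨hΨu.mul hw.2.2, map_mulOp_mul_eq hgH, fun L hL hmem => ?_⟩
  refine dbar_eq_zero hT ?_ hL hmem
  filter_upwards [hΩ'.mem_nhds hw] with z hz v
  rw [ofCont_col_mul_mul]
  exact ((hg z (hsub hz)).2 v).2

end Holomorphic

/-! ### Smooth normalized frames on M -/

section SmoothFrame

variable {M : Type*} [TopologicalSpace M] [ChartedSpace ℂ M] {n : ℕ}

/-- The inverse of `toCircle : UnitAddCircle → Circle`. -/
def angle : Circle → UnitAddCircle := (homeomorphCircle (T := (1 : ℝ)) one_ne_zero).symm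

lemma toCircle_angle (l : Circle) : toCircle (angle l) = l := by
  rw [← homeomorphCircle_apply (T := (1 : ℝ)) one_ne_zero, angle, Homeomorph.apply_symm_apply]

lemma angle_toCircle (t : UnitAddCircle) : angle (toCircle t) = t := by
  rw [← homeomorphCircle_apply (T := (1 : ℝ)) one_ne_zero, angle, Homeomorph.symm_apply_apply]

section SmoothOn

variable {F G : Type*} [NormedAddCommGroup F] [NormedSpace ℝ F] [NormedAddCommGroup G]
  [NormedSpace ℝ G]

/-- The continuous function `t ↦ f (t, z)` defined by a smooth function on `S¹ × U`. -/
lemma SmoothOn.continuous_slice {f : Circle × M → F} {U : Set M} (hf : SmoothOn f U) {z : M}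
    (hz : z ∈ U) : Continuous fun t : UnitAddCircle => f (toCircle t, z) :=
  hf.continuousOn.comp_continuous (continuous_toCircle.prodMk continuous_const)
    fun _ => ⟨mem_univ _, hz⟩

lemma SmoothOn.postcomp {f : Circle × M → F} {U : Set M} {φ : F → G}
    (hφ : ∀ z ∈ U, ∀ l, ContDiffAt ℝ ∞ φ (f (l, z))) (hf : SmoothOn f U) :
    SmoothOn (fun p => φ (f p)) U := fun p hp =>
  (hφ p.2 hp.2 p.1).contMDiffAt.comp_contMDiffWithinAt p (hf p hp)

lemma SmoothOn.at_one {f : Circle × M → F} {U : Set M} (hf : SmoothOn f U) :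
    SmoothOn (fun p => f (1, p.2)) U := by
  refine ContMDiffOn.comp (g := f) (f := fun p : Circle × M => ((1 : Circle), p.2)) hf ?_ ?_
  · exact (contMDiff_const.prodMk contMDiff_snd).contMDiffOn
  · exact fun p hp => ⟨mem_univ _, hp.2⟩

lemma smoothOn_prodMk {f : Circle × M → F} {g : Circle × M → G} {U : Set M}
    (hf : SmoothOn f U) (hg : SmoothOn g U) : SmoothOn (fun p => (f p, g p)) U :=
  ContMDiffOn.prodMk_space hf hg

lemma smoothOn_pi {ι : Type*} [Fintype ι] {f : ι → Circle × M → F} {U : Set M}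
    (hf : ∀ i, SmoothOn (f i) U) : SmoothOn (fun p i => f i p) U :=
  contMDiffOn_pi_space.2 hf

lemma smoothOn_mul_EndCn {A B : Circle × M → EndCn n} {U : Set M} (hA : SmoothOn A U)
    (hB : SmoothOn B U) : SmoothOn (fun p => A p * B p) U :=
  (smoothOn_prodMk hA hB).postcomp (φ := fun q : EndCn n × EndCn n => q.1 * q.2) fun _ _ _ =>
    (contDiffOn_mul_EndCn (s := univ) contDiff_fst.contDiffOn
      contDiff_snd.contDiffOn).contDiffAt Filter.univ_mem

end SmoothOn

/-- A smooth wandering bundle has, locally, smooth normalized frames. -/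
lemma exists_local_frame {V : M → Submodule ℂ (L2 n)} (hinv : ∀ z, (V z).map (shift n) ≤ V z)
    (hsmooth : IsSmoothSubbundle n fun z => wandering (V z)) (z₀ : M) :
    ∃ U : Set M, IsOpen U ∧ z₀ ∈ U ∧ ∃ P : Circle × M → EndCn n, SmoothOn P U ∧
      ∀ z ∈ U, ∃ Ψ : C(UnitAddCircle, EndCn n), IsNormalizedFrame (wandering (V z)) Ψ ∧
        (∀ w ∈ wandering (V z), ∃ v, w = ofCont n (col Ψ v)) ∧
        ∀ t, P (toCircle t, z) = Ψ t := by
  obtain ⟨U, hU, hz₀, f, s, hf, hs, hb⟩ := hsmooth z₀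
  set A : Circle × M → EndCn n := fun p => ofColsL n fun j => f j p with hA
  have hAs : SmoothOn A U := (smoothOn_pi hf).postcomp fun _ _ _ =>
    (contDiff_real_of_clm (ofColsL n)).contDiffAt
  have key : ∀ z ∈ U, ∃ F : C(UnitAddCircle, EndCn n), (∀ t, A (toCircle t, z) = F t) ∧
      (∀ t, IsUnit (F t)) ∧ IsNormalizedFrame (wandering (V z)) (normalize F) ∧
        ∀ w ∈ wandering (V z), ∃ v, w = ofCont n (col (normalize F) v) := by
    intro z hz
    set g : Fin n → C(UnitAddCircle, Cn n) := fun j =>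
      ⟨fun t => f j (toCircle t, z), (hf j).continuous_slice hz⟩
    have hg : (fun j => s j z) = fun j => ofCont n (g j) := by
      funext j
      refine Lp.ext ?_
      filter_upwards [hs j z hz, ofCont_coeFn (g j)] with t h1 h2
      rw [h1, h2]; rfl
    obtain ⟨hli, hsp⟩ := hb z hz
    rw [hg] at hli hsp
    exact ⟨colsC g, fun t => rfl, isUnit_colsC (hinv z) hli hsp,
      isNormalizedFrame_normalize (hinv z) hli hsp⟩
  have hunit : ∀ z ∈ U, IsUnit (A (1, z)) := by
    intro z hz
    obtain ⟨F, hF, hu, -⟩ := key z hz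
    rw [← toCircle_zero (T := (1 : ℝ)), hF]
    exact hu 0
  refine ⟨U, hU, hz₀, fun p => A p * Ring.inverse (A (1, p.2)), ?_, fun z hz => ?_⟩
  · exact smoothOn_mul_EndCn hAs (hAs.at_one.postcomp fun z hz _ =>
      contDiffAt_inverse_real (hunit z hz))
  · obtain ⟨F, hF, hu, h1, h2⟩ := key z hz
    refine ⟨normalize F, h1, h2, fun t => ?_⟩
    simp only
    rw [hF, ← toCircle_zero (T := (1 : ℝ)), hF]
    rfl

/-- A smooth wandering bundle has a global smooth normalized frame. -/
lemma exists_frame {V : M → Submodule ℂ (L2 n)} (hinv : ∀ z, (V z).map (shift n) ≤ V z)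
    (hsmooth : IsSmoothSubbundle n fun z => wandering (V z)) :
    ∃ (P : Circle × M → EndCn n) (Ψ : M → C(UnitAddCircle, EndCn n)), SmoothOn P univ ∧
      (∀ z t, P (toCircle t, z) = Ψ z t) ∧ ∀ z, IsNormalizedFrame (wandering (V z)) (Ψ z) ∧
        ∀ w ∈ wandering (V z), ∃ v, w = ofCont n (col (Ψ z) v) := by
  have h : ∀ z, ∃ Ψ : C(UnitAddCircle, EndCn n), IsNormalizedFrame (wandering (V z)) Ψ ∧
        ∀ w ∈ wandering (V z), ∃ v, w = ofCont n (col Ψ v) := fun z => by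
    obtain ⟨U, -, hz, P, -, hP⟩ := exists_local_frame hinv hsmooth z
    obtain ⟨Ψ, h1, h2, -⟩ := hP z hz
    exact ⟨Ψ, h1, h2⟩
  choose Ψ hΨ hspan using h
  refine ⟨fun p => Ψ p.2 (angle p.1), Ψ, ?_, fun z t => by simp only [angle_toCircle],
    fun z => ⟨hΨ z, hspan z⟩⟩
  rintro ⟨l, z⟩ -
  obtain ⟨U, hU, hz, P, hP, hPU⟩ := exists_local_frame hinv hsmooth z
  have hnhds : univ ×ˢ U ∈ nhds (l, z) := (isOpen_univ.prod hU).mem_nhds ⟨mem_univ _, hz⟩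
  refine ContMDiffAt.contMDiffWithinAt ?_
  refine ((hP (l, z) ⟨mem_univ _, hz⟩).contMDiffAt hnhds).congr_of_eventuallyEq ?_
  filter_upwards [hnhds] with p hp
  obtain ⟨Φ, h1, -, h3⟩ := hPU p.2 hp.2
  -- The frames were chosen point by point, but uniqueness identifies them near z with the smooth
  -- local frame.
  rw [(hΨ p.2).unique (hinv p.2) h1, ← h3, toCircle_angle]

end SmoothFrame

/-! ### Operators as matrices, and the unitary frame -/

section Matrices

variable {n : ℕ}

/-- The matrix of an operator on `ℂⁿ`. -/
def toMat : EndCn n ≃⋆ₐ[ℂ] Matrix (Fin n) (Fin n) ℂ := Matrix.toEuclideanCLM.symm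

lemma toMat_apply (A : EndCn n) (i j : Fin n) : toMat A i j = A (EuclideanSpace.single j 1) i := by
  obtain ⟨B, rfl⟩ : ∃ B, toMat.symm B = A := ⟨toMat A, StarAlgEquiv.symm_apply_apply _ _⟩
  rw [StarAlgEquiv.apply_symm_apply]
  change _ = (Matrix.toEuclideanCLM (𝕜 := ℂ) B) (EuclideanSpace.single j 1) i
  simp

lemma toEuclideanLin_toMat (A : EndCn n) (v : Cn n) : (toMat A).toEuclideanLin v = A v := by
  obtain ⟨B, rfl⟩ : ∃ B, toMat.symm B = A := ⟨toMat A, StarAlgEquiv.symm_apply_apply _ _⟩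
  rw [StarAlgEquiv.apply_symm_apply]
  rfl

lemma toMat_star (A : EndCn n) : toMat (star A) = star (toMat A) := toMat.map_star' A

/-- The entries of the matrix of an operator on `ℂⁿ`. -/
def entryL (i j : Fin n) : EndCn n →L[ℂ] ℂ :=
  (EuclideanSpace.proj i).comp (ContinuousLinearMap.apply ℂ (Cn n) (EuclideanSpace.single j 1))

lemma toMat_eq_entryL (A : EndCn n) (i j : Fin n) : toMat A i j = entryL i j A := toMat_apply A i j

end Matrices

/-- The unitary frame of a smooth bundle of pure shift-invariant subspaces. -/
lemma exists_unitary_frame {M : Type*} [TopologicalSpace M] [ChartedSpace ℂ M] {n : ℕ}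
    {V : M → Submodule ℂ (L2 n)} {P : Circle × M → EndCn n} {Ψ : M → C(UnitAddCircle, EndCn n)}
    (hinv : ∀ z, (V z).map (shift n) ≤ V z) (hP : SmoothOn P univ)
    (hPΨ : ∀ z t, P (toCircle t, z) = Ψ z t)
    (hΨ : ∀ z, IsNormalizedFrame (wandering (V z)) (Ψ z))
    (hV : ∀ z, V z = (hardy n).map (mulOp n (Ψ z)).toLinearMap) :
    ∃ ψ : Circle × M → Matrix (Fin n) (Fin n) ℂ,
      (∀ i j, ContMDiff ((𝓡 1).prod 𝓘(ℝ, ℂ)) 𝓘(ℝ, ℂ) ∞ fun p => ψ p i j) ∧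
      (∀ p, ψ p ∈ Matrix.unitaryGroup (Fin n) ℂ) ∧
      (∀ z, ψ (1, z) = 1) ∧
      ∀ z, V z = matMul (fun l => ψ (l, z)) (hardy n) := by
  refine ⟨fun p => toMat (P p), fun i j => ?_, ?_, fun z => ?_, fun z => ?_⟩
  · have h1 : SmoothOn (fun p => entryL i j (P p)) univ := hP.postcomp fun _ _ _ =>
      (contDiff_real_of_clm (entryL i j)).contDiffAt
    rw [SmoothOn, univ_prod_univ, contMDiffOn_univ] at h1
    simpa only [toMat_eq_entryL] using h1
  · rintro ⟨l, z⟩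
    simp only
    rw [Matrix.mem_unitaryGroup_iff, ← toCircle_angle l, hPΨ, ← toMat_star, ← map_mul,
      (hΨ z).mul_star (hinv z), map_one]
  · simp only
    rw [← toCircle_zero (T := (1 : ℝ)), hPΨ, (hΨ z).map_zero, map_one]
  · rw [matMul_eq_map (B := Ψ z) fun t v => by simp only [hPΨ, toEuclideanLin_toMat]]
    exact hV z

/-! ### The holomorphic frame in a chart -/

section LocalHolomorphic

variable {M : Type*} [TopologicalSpace M] [ChartedSpace ℂ M] {n : ℕ}

/-- The hypothesis is the Cauchy–Riemann equation L(i) = i L(1), which makes the real derivative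
complex linear. -/
lemma differentiableAt_of_dbar_eq_zero {E : Type*} [NormedAddCommGroup E] [NormedSpace ℂ E]
    {u : ℂ → E} {L : ℂ →L[ℝ] E} {w : ℂ} (h : HasFDerivAt u L w)
    (h0 : L 1 + Complex.I • L Complex.I = 0) : DifferentiableAt ℂ u w := by
  rw [differentiableAt_complex_iff_differentiableAt_real, h.fderiv]
  refine ⟨h.differentiableAt, ?_⟩
  rw [eq_neg_of_add_eq_zero_left h0, smul_neg, smul_smul, Complex.I_mul_I, neg_smul, one_smul,
    neg_neg]

lemma mdifferentiableOn_comp_chart [IsManifold 𝓘(ℂ, ℂ) ω M] {X Y : Type*} [NormedAddCommGroup X]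
    [NormedSpace ℂ X] [NormedAddCommGroup Y] [NormedSpace ℂ Y] (m : X →L[ℂ] Y) {u : ℂ → X}
    {e : OpenPartialHomeomorph M ℂ} (he : e ∈ atlas ℂ M) {U : Set M} (hU : U ⊆ e.source)
    (hu : ∀ z ∈ U, DifferentiableAt ℂ u (e z)) :
    MDifferentiableOn 𝓘(ℂ, ℂ) 𝓘(ℂ, Y) (fun z => m (u (e z))) U := by
  have : IsManifold 𝓘(ℂ, ℂ) 1 M := IsManifold.of_le (n := ω) le_top
  intro z hz
  have h1 : DifferentiableAt ℂ (fun w => m (u w)) (e z) :=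
    m.differentiableAt.comp (e z) (hu z hz)
  exact (h1.mdifferentiableAt.comp z (mdifferentiableAt_atlas he (hU hz))).mdifferentiableWithinAt

/-- The `z̄`-derivative of a column of a differentiable operator function. -/
lemma dbar_eq {M : Type*} [TopologicalSpace M] {u : ℂ → C(UnitAddCircle, EndCn n)}
    {e : OpenPartialHomeomorph M ℂ} {z : M}
    (hz : z ∈ e.source) {t : UnitAddCircle} {L : ℂ →L[ℝ] EndCn n}
    (hL : HasFDerivAt (fun w => u w t) L (e z)) (v : Cn n) :
    dbar e (fun x => u (e x) t v) z = (1 / 2 : ℂ) • (L 1 + Complex.I • L Complex.I) v := by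
  obtain ⟨N, hN, hN'⟩ := exists_hasFDerivAt_clm (ContinuousLinearMap.apply ℂ (Cn n) v) hL
  have h1 : HasFDerivAt ((fun x => u (e x) t v) ∘ e.symm) N (e z) := by
    refine hN.congr_of_eventuallyEq ?_
    filter_upwards [e.open_target.mem_nhds (e.map_source hz)] with w hw
    simp only [Function.comp_apply, e.right_inv hw, ContinuousLinearMap.apply_apply]
  rw [dbar, h1.fderiv, hN', hN']
  rfl

lemma ofCont_col_mem {A : C(UnitAddCircle, EndCn n)} (v : Cn n) :
    ofCont n (col A v) ∈ (hardy n).map (mulOp n A).toLinearMap := by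
  rw [← mulOp_constL]
  exact Submodule.mem_map_of_mem (constL_mem_hardy v)

/-- Near every point, a `∂̄`-invariant bundle has a frame holomorphic in the base point. -/
lemma exists_local_holomorphic_frame [IsManifold 𝓘(ℂ, ℂ) ω M]
    {V : M → Submodule ℂ (L2 n)} {P : Circle × M → EndCn n} {Ψ : M → C(UnitAddCircle, EndCn n)}
    (hP : SmoothOn P univ) (hPΨ : ∀ z t, P (toCircle t, z) = Ψ z t)
    (h1 : ∀ z, Ψ z * adjC (Ψ z) = 1) (h2 : ∀ z, adjC (Ψ z) * Ψ z = 1)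
    (hV : ∀ z, V z = (hardy n).map (mulOp n (Ψ z)).toLinearMap) (hdbar : DbarInvariant V)
    (z₀ : M) :
    ∃ U : Set M, IsOpen U ∧ z₀ ∈ U ∧ U ⊆ (chartAt ℂ z₀).source ∧
      ∃ u : ℂ → C(UnitAddCircle, EndCn n),
        SmoothOn (fun p : Circle × M => u (chartAt ℂ z₀ p.2) (angle p.1)) U ∧
        ∀ z ∈ U, DifferentiableAt ℂ u (chartAt ℂ z₀ z) ∧ IsUnit (u (chartAt ℂ z₀ z)) ∧
          V z = (hardy n).map (mulOp n (u (chartAt ℂ z₀ z))).toLinearMap := by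
  have : IsManifold 𝓘(ℝ, ℂ) ∞ M := isManifold_real
  set e := chartAt ℂ z₀ with he_def
  have he : e ∈ atlas ℂ M := chart_mem_atlas ℂ z₀
  have hpull : ContDiffOn ℝ ∞ (fun q : ℂ × ℝ => pull e P (q.2, q.1)) (e.target ×ˢ univ) :=
    (contDiffOn_pull he hP).comp (by fun_prop) fun q hq => ⟨mem_univ _, hq.1, mem_univ _⟩
  obtain ⟨Ω, hΩt, hΩ, hz₀Ω, u, υ, hυ, huυ, hu⟩ :=
    exists_holomorphic_factor e.open_target (mem_chart_target ℂ z₀) (Ψ := fun w => Ψ (e.symm w))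
      (fun w _ h => (hPΨ (e.symm w) h).symm) hpull (fun w _ => h1 _) (fun w _ => h2 _)
  set U : Set M := e.source ∩ e ⁻¹' Ω with hU_def
  have hU : IsOpen U := e.isOpen_inter_preimage hΩ
  have hUs : U ⊆ e.source := inter_subset_left
  have hVu : ∀ z ∈ U, V z = (hardy n).map (mulOp n (u (e z))).toLinearMap := fun z hz => by
    rw [(hu (e z) hz.2).2.1, e.left_inv hz.1, hV z]
  have huS : SmoothOn (fun p : Circle × M => u (e p.2) (angle p.1)) U := by
    refine smoothOn_of_pull he hU hUs ?_
    have hs : MapsTo (fun q : ℝ × ℂ => (q.2, q.1)) (univ ×ˢ (e '' U)) (Ω ×ˢ univ) := by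
      rintro ⟨h, w⟩ ⟨-, z, hz, rfl⟩
      exact ⟨hz.2, mem_univ _⟩
    have h3 : ContDiffOn ℝ ∞ (fun q : ℝ × ℂ => υ (q.2, q.1)) (univ ×ˢ (e '' U)) :=
      hυ.comp (by fun_prop) hs
    refine h3.congr fun q hq => ?_
    rw [pull, e.right_inv (hΩt (hs hq).1), angle_toCircle, huυ _ (hs hq).1]
  obtain ⟨u', -, hu't, hu'⟩ := exists_fderivC hΩ huυ (hυ.of_le (by exact_mod_cast le_top))
  refine ⟨U, hU, ⟨mem_chart_source ℂ z₀, hz₀Ω⟩, hUs, u, huS, fun z hz =>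
    ⟨differentiableAt_of_dbar_eq_zero (hu' _ hz.2) ?_, (hu _ hz.2).1, hVu z hz⟩⟩
  refine (hu _ hz.2).2.2 _ (hu' _ hz.2) fun v => ?_
  -- The columns of u are smooth local sections of V, so (iii) applies to them.
  have hsec : FunMem (V z) fun l => dbar e (fun x => u (e x) (angle l) v) z := by
    refine hdbar U (fun p => u (e p.2) (angle p.1) v) hU ?_ (fun x hx => ?_) z hz e he hz.1
    · exact huS.postcomp (φ := fun A : EndCn n => A v) fun _ _ _ =>
        (contDiff_real_of_clm (ContinuousLinearMap.apply ℂ (Cn n) v)).contDiffAt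
    · refine funMem_of_ofCont (G := col (u (e x)) v) ?_ fun t => ?_
      · rw [hVu x hx]; exact ofCont_col_mem v
      · simp only [col_apply, angle_toCircle]
  have h4 := hsec.ofCont (G := (1 / 2 : ℂ) • col (applyC (u' (e z)) 1 +
    Complex.I • applyC (u' (e z)) Complex.I) v) fun t => by
      simp only [angle_toCircle]
      rw [dbar_eq hz.1 (hu't _ hz.2 t)]
      rfl
  rw [map_smul, Submodule.smul_mem_iff _ (by norm_num), hVu z hz, (hu (e z) hz.2).2.1] at h4
  exact h4

end LocalHolomorphic

/-! ### Matrix frames and the holomorphic subbundle -/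

section HolomorphicBundle

variable {M : Type*} [TopologicalSpace M] [ChartedSpace ℂ M] [IsManifold 𝓘(ℂ, ℂ) ω M] {n : ℕ}

/-- Evaluation of a matrix entry of an operator function. -/
def entryEval (i j : Fin n) (t : UnitAddCircle) : C(UnitAddCircle, EndCn n) →L[ℂ] ℂ :=
  (entryL i j).comp (ContinuousMap.evalCLM ℂ t)

lemma entryEval_apply (i j : Fin n) (t : UnitAddCircle) (A : C(UnitAddCircle, EndCn n)) :
    entryEval i j t A = toMat (A t) i j := (toMat_eq_entryL _ _ _).symm

lemma isUnit_apply {A : C(UnitAddCircle, EndCn n)} (h : IsUnit A) (t : UnitAddCircle) :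
    IsUnit (A t) := by
  obtain ⟨B, hB, hB'⟩ := isUnit_iff_exists.1 h
  exact isUnit_iff_exists.2 ⟨B t, DFunLike.congr_fun hB t, DFunLike.congr_fun hB' t⟩

lemma isUnit_mulOp {A : C(UnitAddCircle, EndCn n)} (h : IsUnit A) : IsUnit (mulOp n A) :=
  h.map (mulOpHom n)

/-- Matrix form of a local holomorphic frame. -/
lemma exists_matrix_frame {V : M → Submodule ℂ (L2 n)} {U : Set M} {e : OpenPartialHomeomorph M ℂ}
    (he : e ∈ atlas ℂ M) (hU : U ⊆ e.source) {u : ℂ → C(UnitAddCircle, EndCn n)}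
    (hu : SmoothOn (fun p : Circle × M => u (e p.2) (angle p.1)) U)
    (h : ∀ z ∈ U, DifferentiableAt ℂ u (e z) ∧ IsUnit (u (e z)) ∧
      V z = (hardy n).map (mulOp n (u (e z))).toLinearMap) :
    ∃ u : Circle × M → Matrix (Fin n) (Fin n) ℂ,
      (∀ i j, SmoothOn (fun p => u p i j) U) ∧
      (∀ l, ∀ z ∈ U, IsUnit (u (l, z))) ∧
      (∀ l i j, MDifferentiableOn 𝓘(ℂ, ℂ) 𝓘(ℂ, ℂ) (fun z => u (l, z) i j) U) ∧
      ∀ z ∈ U, V z = matMul (fun l => u (l, z)) (hardy n) := by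
  refine ⟨fun p => toMat (u (e p.2) (angle p.1)), fun i j => ?_, fun l z hz => ?_,
    fun l i j => ?_, fun z hz => ?_⟩
  · simp only [toMat_eq_entryL]
    exact hu.postcomp fun _ _ _ => (contDiff_real_of_clm (entryL i j)).contDiffAt
  · exact (isUnit_apply (h z hz).2.1 (angle l)).map toMat
  · simp only [← entryEval_apply]
    exact mdifferentiableOn_comp_chart (X := C(UnitAddCircle, EndCn n)) (entryEval i j (angle l))
      he hU fun z hz => (h z hz).1
  · rw [matMul_eq_map (B := u (e z)) fun t v => by simp only [angle_toCircle, toEuclideanLin_toMat]]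
    exact (h z hz).2.2

end HolomorphicBundle

end ShiftBundle

end

theorem mainTheorem4 {M : Type*} [TopologicalSpace M] [ChartedSpace ℂ M] [IsManifold 𝓘(ℂ, ℂ) ω M]
    (n : ℕ) (V : M → Submodule ℂ (L2 n))
    (hclosed : ∀ z, IsClosed (V z : Set (L2 n)))
    (hinv : ∀ z, (V z).map (shift n) ≤ V z)
    (hpure : ∀ z, IsPureShift (V z))
    (hsmooth : IsSmoothSubbundle n fun z => wandering (V z)) :
    (∃ ψ : Circle × M → Matrix (Fin n) (Fin n) ℂ,
      (∀ i j, ContMDiff ((𝓡 1).prod 𝓘(ℝ, ℂ)) 𝓘(ℝ, ℂ) ∞ fun p => ψ p i j) ∧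
      (∀ p, ψ p ∈ Matrix.unitaryGroup (Fin n) ℂ) ∧
      (∀ z, ψ (1, z) = 1) ∧
      ∀ z, V z = matMul (fun l => ψ (l, z)) (hardy n)) ∧
    (DbarInvariant V →
      (∀ z₀ : M, ∃ U : Set M, IsOpen U ∧ z₀ ∈ U ∧
        ∃ u : Circle × M → Matrix (Fin n) (Fin n) ℂ,
          (∀ i j, SmoothOn (fun p => u p i j) U) ∧
          (∀ l, ∀ z ∈ U, IsUnit (u (l, z))) ∧
          (∀ l i j, MDifferentiableOn 𝓘(ℂ, ℂ) 𝓘(ℂ, ℂ) (fun z => u (l, z) i j) U) ∧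
          ∀ z ∈ U, V z = matMul (fun l => u (l, z)) (hardy n)) ∧
      IsHolomorphicSubbundle V) := by
  obtain ⟨P, Ψ, hP, hPΨ, hΨ⟩ := exists_frame hinv hsmooth
  have hV : ∀ z, V z = (hardy n).map (mulOp n (Ψ z)).toLinearMap := fun z =>
    (hΨ z).1.eq_map_hardy (hclosed z) (hinv z) (hpure z) (hΨ z).2
  refine ⟨exists_unitary_frame hinv hP hPΨ (fun z => (hΨ z).1) hV, fun hdbar => ?_⟩
  have key := exists_local_holomorphic_frame hP hPΨ (fun z => (hΨ z).1.mul_adjC (hinv z))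
    (fun z => (hΨ z).1.adjC_mul (hinv z)) hV hdbar
  refine ⟨fun z₀ => ?_, fun z₀ => ?_⟩
  · obtain ⟨U, hU, hz₀, hUs, u, hu, h⟩ := key z₀
    exact ⟨U, hU, hz₀, exists_matrix_frame (chart_mem_atlas ℂ z₀) hUs hu h⟩
  · obtain ⟨U, hU, hz₀, hUs, u, hu, h⟩ := key z₀
    -- The trivialization is multiplication by u: it is holomorphic in operator norm because u is
    -- holomorphic into C(S¹) and `mulOp` is bounded and linear.
    exact ⟨U, hU, hz₀, hardy n, fun z => mulOp n (u (chartAt ℂ z₀ z)), isClosed_hardy n,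
      mdifferentiableOn_comp_chart (X := C(UnitAddCircle, EndCn n)) (mulOp n)
        (chart_mem_atlas ℂ z₀) hUs fun z hz => (h z hz).1,
      fun z hz => ⟨isUnit_mulOp (h z hz).2.1, (h z hz).2.2⟩⟩
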